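/- All logarithms are to base $2$. In the $k$-secretary problem an adversary assigns nonnegative real values to $n$ items with indices $1,\dots,n$; write $v(1)\ge v(2)\ge\dots\ge v(n)\ge 0$ for these values in non-increasing order (ties between items are broken by an arbitrary fixed ranking consistent with the values). The items arrive in the order $\sigma(1),\dots,\sigma(n)$ given by a permutation $\sigma$ of $[n]$ that is drawn from a distribution which does not depend on the adversary's assignment. The deterministic single-threshold wait-and-pick algorithm with time threshold $m$ and statistic $\tau$ observes the first $m$ items, and then selects the first $k$ arriving items that are ranked above the $\tau$-th largest of the $m$ observed items; $ALG(\sigma)$ denotes the sum of the selected values for $m=\lfloor n/k^{1/3}\rfloor$ and $\tau=\lfloor k^{2/3}\rfloor$. **Theorem.** There are an absolute constant $C$, an absolute threshold $n_0$ and a deterministic algorithm such that for all $n\ge n_0$ and all integers $k$ with $2\le k\le \frac{\log n}{\log\log n}$ the algorithm, on input $(n,k)$, computes in time polynomial in $n$ a nonempty multi-set $\mathcal L$ of permutations of $[n]$ for which the following holds. Let $\mathcal D$ be the uniform distribution on $\mathcal L$. Then $\log|\mathcal L|\le C\log\log n$, so that $\mathcal D$ has Shannon entropy at most $C\log\log n$,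 and for every assignment of values by the adversary $$\mathbb E_{\sigma\sim\mathcal D}\big(ALG(\sigma)\big)\;\ge\;\Big(1-\frac{k^2}{\sqrt{\log n}}\Big)\Big(1-\frac{5\log k}{k^{1/3}}\Big)\sum_{i=1}^{k}v(i).$$ -/

import Mathlib

/-! ### Wait-and-pick algorithms for the `k`-secretary problem

Items, positions and ranks are numbered from `0`.  An arrival order is a permutation `σ` of the item
indices: the item `σ p` arrives at position `p`.  The rank of an item is its place in the order of
decreasing values (rank `0` is the best item).  A function `r : Fin n → Fin n` below
lists the ranks of the arriving items in their order of arrival.  -/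

/-- The item at position `q` is the `τ`-th largest among the items at the first `m` positions. -/
def IsStatistic {n : ℕ} (m τ : ℕ) (r : Fin n → Fin n) (q : Fin n) : Prop :=
  (q : ℕ) < m ∧
    (Finset.univ.filter (fun q' : Fin n => (q' : ℕ) < m ∧ r q' ≤ r q)).card = τ

instance {n : ℕ} (m τ : ℕ) (r : Fin n → Fin n) : DecidablePred (IsStatistic m τ r) :=
  fun _ => inferInstanceAs (Decidable (_ ∧ _))

/-- The item at position `p` arrives after the observation period (the first `m` positions) and
is better than the `τ`-th largest item of the observation period. -/
def BeatsStatistic {n : ℕ} (m τ : ℕ) (r : Fin n → Fin n) (p : Fin n) : Prop :=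
  m ≤ (p : ℕ) ∧ ∃ q : Fin n, IsStatistic m τ r q ∧ r p < r q

instance {n : ℕ} (m τ : ℕ) (r : Fin n → Fin n) : DecidablePred (BeatsStatistic m τ r) :=
  fun _ => inferInstanceAs (Decidable (_ ∧ _))

/-- The positions at which the deterministic wait-and-pick `k`-secretary algorithm with time
threshold `m` and statistic `τ` selects an item: it observes the first `m` items, and then
selects the first `k` items that are better than the `τ`-th largest observed item. -/
def waitAndPick {n : ℕ} (m τ k : ℕ) (r : Fin n → Fin n) : Finset (Fin n) :=
  Finset.univ.filter (fun p => BeatsStatistic m τ r p ∧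
    (Finset.univ.filter (fun p' : Fin n => p' < p ∧ BeatsStatistic m τ r p')).card < k)

/-- The sum of the values selected by the wait-and-pick algorithm on the arrival order `σ`, when
the values in non-increasing order are `v 0, v 1, …` and the adversary has given the
value `v (a i)` to the item with index `i`. -/
def waitAndPickValue {n : ℕ} (m τ k : ℕ) (v : Fin n → ℝ) (a : Equiv.Perm (Fin n))
    (σ : Equiv.Perm (Fin n)) : ℝ :=
  ∑ p ∈ waitAndPick m τ k (fun p => a (σ p)), v (a (σ p))

/-! ### Distributions on permutations -/

/-- The uniform distribution on a (nonempty) multi-set of permutations, given as a list. -/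
noncomputable def uniformOn {n : ℕ} (L : List (Equiv.Perm (Fin n))) (π : Equiv.Perm (Fin n)) : ℝ :=
  (L.count π : ℝ) / (L.length : ℝ)

/-- The expectation of `f` under the distribution `D`. -/
noncomputable def expectation {n : ℕ} (D : Equiv.Perm (Fin n) → ℝ) (f : Equiv.Perm (Fin n) → ℝ) :
    ℝ :=
  ∑ π : Equiv.Perm (Fin n), D π * f π

/-- The Shannon entropy in bits (with `0 * log 0 = 0`). -/
noncomputable def shannonEntropy {n : ℕ} (D : Equiv.Perm (Fin n) → ℝ) : ℝ :=
  - ∑ π : Equiv.Perm (Fin n), D π * Real.logb 2 (D π)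

/-! ### A random access machine with logarithmic cost

Programs are structured programs over a memory that consists of arrays of natural
numbers; an array cell is addressed by the number of the array (fixed in the program) and an index,
which is computed at run time.  Every operation costs one unit plus the bit lengths of all numbers
that it handles (the logarithmic cost criterion). -/

namespace Ram

/-- A memory: `s a i` is the content of cell `i` of array `a`. -/
abbrev State := ℕ → ℕ → ℕ

/-- Expressions; `cell a i` is the content of the cell of array `a` with index `i`. -/
inductive Expr : Type
  | const (c : ℕ) : Expr
  | cell (a : ℕ) (i : Expr) : Expr
  | add (e f : Expr) : Expr
  | sub (e f : Expr) : Expr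
  | mul (e f : Expr) : Expr
  | div (e f : Expr) : Expr
  | mod (e f : Expr) : Expr

/-- The value of an expression (subtraction is truncated at `0`, and division is integer division,
with `x / 0 = 0` and `x % 0 = x`). -/
def Expr.val (s : State) : Expr → ℕ
  | const c => c
  | cell a i => s a (i.val s)
  | add e f => e.val s + f.val s
  | sub e f => e.val s - f.val s
  | mul e f => e.val s * f.val s
  | div e f => e.val s / f.val s
  | mod e f => e.val s % f.val s

/-- The cost of evaluating an expression; `Nat.size` is the bit length. -/
def Expr.cost (s : State) : Expr → ℕ
  | const c => 1 + c.size
  | cell a i => i.cost s + (1 + (i.val s).size + (s a (i.val s)).size)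
  | add e f => e.cost s + f.cost s + (1 + (e.val s).size + (f.val s).size)
  | sub e f => e.cost s + f.cost s + (1 + (e.val s).size + (f.val s).size)
  | mul e f => e.cost s + f.cost s + (1 + (e.val s).size + (f.val s).size)
  | div e f => e.cost s + f.cost s + (1 + (e.val s).size + (f.val s).size)
  | mod e f => e.cost s + f.cost s + (1 + (e.val s).size + (f.val s).size)

/-- Programs.  `assign a i e` stores the value of `e` in cell `i` of array `a`; `ite e c d` runs `c`
if the value of `e` is not `0`, and `d` otherwise; `loop e c` runs `c` as long as the value of `e`
is not `0`. -/
inductive Prog : Type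
  | skip : Prog
  | assign (a : ℕ) (i e : Expr) : Prog
  | seq (c d : Prog) : Prog
  | ite (e : Expr) (c d : Prog) : Prog
  | loop (e : Expr) (c : Prog) : Prog

/-- The memory `s` after `x` has been stored in cell `i` of array `a`. -/
def State.store (s : State) (a i x : ℕ) : State :=
  Function.update s a (Function.update (s a) i x)

/-- `Exec c s t s'`: the program `c`, started in the memory `s`, halts at total cost `t` with the
memory `s'`. -/
inductive Exec : Prog → State → ℕ → State → Prop
  | skip (s : State) : Exec Prog.skip s 1 s
  | assign (a : ℕ) (i e : Expr) (s : State) :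
      Exec (Prog.assign a i e) s
        (i.cost s + e.cost s + (1 + (i.val s).size + (e.val s).size))
        (State.store s a (i.val s) (e.val s))
  | seq {c d : Prog} {s s' s'' : State} {t t' : ℕ} (hc : Exec c s t s') (hd : Exec d s' t' s'') :
      Exec (Prog.seq c d) s (t + t') s''
  | ite_true {e : Expr} {c d : Prog} {s s' : State} {t : ℕ} (he : e.val s ≠ 0)
      (hc : Exec c s t s') : Exec (Prog.ite e c d) s (e.cost s + 1 + t) s'
  | ite_false {e : Expr} {c d : Prog} {s s' : State} {t : ℕ} (he : e.val s = 0)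
      (hd : Exec d s t s') : Exec (Prog.ite e c d) s (e.cost s + 1 + t) s'
  | loop_done {e : Expr} {c : Prog} {s : State} (he : e.val s = 0) :
      Exec (Prog.loop e c) s (e.cost s + 1) s
  | loop_step {e : Expr} {c : Prog} {s s' s'' : State} {t t' : ℕ} (he : e.val s ≠ 0)
      (hc : Exec c s t s') (hl : Exec (Prog.loop e c) s' t' s'') :
      Exec (Prog.loop e c) s (e.cost s + 1 + t + t') s''

/-- The initial memory on input `n, k`: these numbers are in the cells `0` and `1` of array `0`, and
all other cells are `0`. -/
def input (n k : ℕ) : State :=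
  State.store (State.store (fun _ _ => 0) 0 0 n) 0 1 k

/-- The memory holds the multi-set `L` of permutations as output: their number is in cell `0` of
array `0`, and array `1` holds their tables, one after the other. -/
def Outputs {n : ℕ} (s : State) (L : List (Equiv.Perm (Fin n))) : Prop :=
  s 0 0 = L.length ∧
    ∀ (j : Fin L.length) (p : Fin n), s 1 ((j : ℕ) * n + (p : ℕ)) = ((L.get j p : Fin n) : ℕ)

end Ram

/-!
The multi-set consists of `q ^ 4` permutations, where `q` is the least prime greater than `ℓ ^ 4`
and `ℓ` is the bit length of `n`; it does not depend on `k`. A seed consists of a point `u` of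
`𝔽_q` and of a quadratic polynomial `g` over `𝔽_q`. An item `x` is hashed to the value at `u` of
the polynomial whose coefficients are the base-`q` digits of `x`, the value of `g` at this hash is
the label of `x`, and the items arrive by increasing labels. Since `q` is polynomial in `log n`,
the entropy is `O(log log n)`.

The claim is only of interest if both factors on the left-hand side are positive. Then `k ^ 4 ≤
log n`, the cube root `κ` of `k` is large, and `5 log k ≥ 70`, so that a ratio of `1 - 47 / κ`
suffices. There is room for this because only expected losses matter, and these are controlled by
second moments: no exponential concentration is needed.

* For most `u` the `2 k` best items have different hashes, as two digit polynomials agree at few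
  points (`card_collision_le`).
* The values of `g` at three points are independent and uniform (`sum_quadEval_mul`). So, given
  the label of the item of rank `i`, the other labels are pairwise independent, and the number of
  items among a given set with a label below a bound obeys Chebyshev's inequality
  (`lowCount_chebyshev`). Applied to all of `𝔽_q`, and as each hash occurs about equally often,
  this also locates the label at which the observation period ends (`Params.card_low_le`,
  `Params.card_high_le`).
* The item of rank `i` is lost if it is observed, which has probability about `1 / κ`, if `τ`
  better items are observed, or if `k` items that beat the statistic arrive before it. The second
  event has probability `O(κ ^ 4 / (k - i) ^ 2)` (`Params.card_stat_low_le`). For the third one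
  let `1 - δ` be the relative position of the label of the item; unless fewer than `τ` of the `k +
  k δ / 2` best items are observed, or `k` of these arrive before the item, the event does not
  occur, and so its conditional probability is `O(1 / (κ δ) ^ 2)` (`Params.card_stat_high_le`,
  `Params.card_early_le`).
* As probabilities are at most `1`, summing over `i` gives `O(κ ^ 2)`, and averaging over `δ`
  gives `O(1 / κ)` (`sum_min_sq_div_le`). The bounds increase with `i` while the values decrease,
  so Chebyshev's sum inequality bounds the expected loss by `47 / κ` times the optimum
  (`Params.competitive`).

The running time is bounded in a Hoare logic in which every memory cell and every number of
iterations is at most some `M` polynomial in `n`; the cost of the program is then at most a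
polynomial in `M` that is read off from the program (`Ram.Prog.costPoly`).
-/

/-! ### Time bounds for programs -/

namespace Ram

open Polynomial

/-- A polynomial in `M` that bounds the value of an expression in every memory whose cells are all
at most `M`. -/
noncomputable def Expr.valPoly : Expr → ℕ[X]
  | const c => C c
  | cell _ _ => X
  | add e f => e.valPoly + f.valPoly
  | sub e _ => e.valPoly
  | mul e f => e.valPoly * f.valPoly
  | div e _ => e.valPoly
  | mod e _ => e.valPoly

/-- A polynomial in `M` that bounds the cost of an expression in every memory whose cells are all
at most `M`; bit lengths are crudely bounded by the numbers themselves. -/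
noncomputable def Expr.costPoly : Expr → ℕ[X]
  | const c => C (1 + c)
  | cell _ i => i.costPoly + (1 + i.valPoly + X)
  | add e f => e.costPoly + f.costPoly + (1 + e.valPoly + f.valPoly)
  | sub e f => e.costPoly + f.costPoly + (1 + e.valPoly + f.valPoly)
  | mul e f => e.costPoly + f.costPoly + (1 + e.valPoly + f.valPoly)
  | div e f => e.costPoly + f.costPoly + (1 + e.valPoly + f.valPoly)
  | mod e f => e.costPoly + f.costPoly + (1 + e.valPoly + f.valPoly)

/-- A polynomial in `M` that bounds the cost of a program all of whose loops make at most `M`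
iterations and which only meets memories whose cells are all at most `M`. -/
noncomputable def Prog.costPoly : Prog → ℕ[X]
  | skip => 1
  | assign _ i e => i.costPoly + e.costPoly + (1 + i.valPoly + e.valPoly)
  | seq c d => c.costPoly + d.costPoly
  | ite e c d => e.costPoly + 1 + (c.costPoly + d.costPoly)
  | loop e c => X * (e.costPoly + 1 + c.costPoly) + (e.costPoly + 1)

/-- All memory cells contain numbers that are at most `M`. -/
def Bounded (M : ℕ) (s : State) : Prop := ∀ a i, s a i ≤ M

theorem size_le_self (x : ℕ) : x.size ≤ x := Nat.size_le.2 Nat.lt_two_pow_self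

theorem Bounded.val_le {M : ℕ} {s : State} (hs : Bounded M s) (e : Expr) :
    e.val s ≤ e.valPoly.eval M := by
  induction e with
  | const c => simp [Expr.val, Expr.valPoly]
  | cell a i _ => simpa [Expr.val, Expr.valPoly] using hs a _
  | add e f he hf => simpa [Expr.val, Expr.valPoly] using Nat.add_le_add he hf
  | sub e f he hf => exact (Nat.sub_le _ _).trans he
  | mul e f he hf => simpa [Expr.val, Expr.valPoly] using Nat.mul_le_mul he hf
  | div e f he hf => exact (Nat.div_le_self _ _).trans he
  | mod e f he hf => exact (Nat.mod_le _ _).trans he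

theorem Bounded.size_val_le {M : ℕ} {s : State} (hs : Bounded M s) (e : Expr) :
    (e.val s).size ≤ e.valPoly.eval M :=
  (size_le_self _).trans (hs.val_le e)

theorem Bounded.cost_le {M : ℕ} {s : State} (hs : Bounded M s) (e : Expr) :
    e.cost s ≤ e.costPoly.eval M := by
  induction e with
  | const c => simpa [Expr.cost, Expr.costPoly] using size_le_self c
  | cell a i hi =>
    have h1 := hs.size_val_le i
    have h2 := (size_le_self _).trans (hs a (i.val s))
    simp only [Expr.cost, Expr.costPoly, eval_add, eval_one, eval_X]
    omega
  | add e f he hf | sub e f he hf | mul e f he hf | div e f he hf | mod e f he hf =>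
    have h1 := hs.size_val_le e
    have h2 := hs.size_val_le f
    simp only [Expr.cost, Expr.costPoly, eval_add, eval_one]
    omega

theorem store_apply (s : State) (a i x b j : ℕ) :
    s.store a i x b j = if b = a ∧ j = i then x else s b j := by
  unfold State.store
  by_cases hb : b = a
  · subst hb
    by_cases hj : j = i
    · subst hj; simp
    · simp [hj]
  · simp [hb]

theorem Bounded.store {M : ℕ} {s : State} (hs : Bounded M s) {x : ℕ} (hx : x ≤ M) (a i : ℕ) :
    Bounded M (s.store a i x) := by
  intro b j
  rw [store_apply]
  split_ifs
  · exact hx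
  · exact hs b j

/-- Total correctness with a time bound: started in a memory satisfying `P`, the program halts
within the time given by its cost polynomial at `M`, in a memory satisfying `Q`. -/
def Hoare (M : ℕ) (P : State → Prop) (c : Prog) (Q : State → Prop) : Prop :=
  ∀ s, P s → ∃ t s', Exec c s t s' ∧ t ≤ c.costPoly.eval M ∧ Q s'

variable {M : ℕ} {P P' Q Q' R : State → Prop}

theorem Hoare.assign {a : ℕ} {i e : Expr}
    (h : ∀ s, P s → Bounded M s ∧ Q (s.store a (i.val s) (e.val s))) :
    Hoare M P (Prog.assign a i e) Q := by
  intro s hs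
  obtain ⟨hb, hq⟩ := h s hs
  refine ⟨_, _, Exec.assign a i e s, ?_, hq⟩
  have h1 := hb.cost_le i
  have h2 := hb.cost_le e
  have h3 := hb.size_val_le i
  have h4 := hb.size_val_le e
  simp only [Prog.costPoly, eval_add, eval_one]
  omega

theorem Hoare.seq {c d : Prog} (hc : Hoare M P c R) (hd : Hoare M R d Q) :
    Hoare M P (Prog.seq c d) Q := by
  intro s hs
  obtain ⟨t, s', h1, h2, h3⟩ := hc s hs
  obtain ⟨t', s'', h4, h5, h6⟩ := hd s' h3
  refine ⟨_, _, Exec.seq h1 h4, ?_, h6⟩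
  simpa [Prog.costPoly] using Nat.add_le_add h2 h5

theorem Hoare.weaken {c : Prog} (h : Hoare M P c Q) (hP : ∀ s, P' s → P s)
    (hQ : ∀ s, Q s → Q' s) : Hoare M P' c Q' := by
  intro s hs
  obtain ⟨t, s', h1, h2, h3⟩ := h s (hP s hs)
  exact ⟨t, s', h1, h2, hQ _ h3⟩

/-- The rule for a loop that makes exactly `N` iterations, with the invariant `I i` after `i`
iterations. -/
theorem Hoare.loop {e : Expr} {c : Prog} {N : ℕ} (I : ℕ → State → Prop) (hN : N ≤ M)
    (hb : ∀ i s, I i s → Bounded M s)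
    (hne : ∀ i s, i < N → I i s → e.val s ≠ 0) (h0 : ∀ s, I N s → e.val s = 0)
    (hc : ∀ i, i < N → Hoare M (I i) c (I (i + 1))) :
    Hoare M (I 0) (Prog.loop e c) (I N) := by
  have key : ∀ j i, i + j = N → ∀ s, I i s → ∃ t s', Exec (Prog.loop e c) s t s' ∧
      t ≤ j * (e.costPoly.eval M + 1 + c.costPoly.eval M) + (e.costPoly.eval M + 1) ∧ I N s' := by
    intro j
    induction j with
    | zero =>
      intro i hi s hs
      obtain rfl : i = N := by omega
      refine ⟨_, s, Exec.loop_done (h0 s hs), ?_, hs⟩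
      have := (hb _ _ hs).cost_le e
      omega
    | succ j ih =>
      intro i hi s hs
      obtain ⟨t, s', h1, h2, h3⟩ := hc i (by omega) s hs
      obtain ⟨t', s'', h4, h5, h6⟩ := ih (i + 1) (by omega) s' h3
      refine ⟨_, _, Exec.loop_step (hne i s (by omega) hs) h1 h4, ?_, h6⟩
      have := (hb _ _ hs).cost_le e
      rw [Nat.succ_mul]
      omega
  intro s hs
  obtain ⟨t, s', h1, h2, h3⟩ := key N 0 (by omega) s hs
  refine ⟨t, s', h1, h2.trans ?_, h3⟩
  simp only [Prog.costPoly, eval_add, eval_mul, eval_X, eval_one]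
  gcongr

end Ram

/-! ### The permutations and the program that computes them -/

/-- The place of `x < n` when the numbers below `n` are sorted by increasing `f`. -/
def sortPosition (n : ℕ) (f : ℕ → ℕ) (x : ℕ) : ℕ := ((Finset.range n).filter (f · < f x)).card

theorem sortPosition_lt {n x : ℕ} (f : ℕ → ℕ) (hx : x < n) : sortPosition n f x < n := by
  conv_rhs => rw [← Finset.card_range n]
  apply Finset.card_lt_card
  rw [Finset.ssubset_iff_of_subset (Finset.filter_subset _ _)]
  exact ⟨x, by simpa using hx, by simp⟩

theorem sortPosition_lt_sortPosition {n x y : ℕ} {f : ℕ → ℕ} (hx : x < n) (h : f x < f y) :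
    sortPosition n f x < sortPosition n f y := by
  apply Finset.card_lt_card
  rw [Finset.ssubset_iff_of_subset
    (Finset.monotone_filter_right _ fun t _ (ht : f t < f x) => ht.trans h)]
  exact ⟨x, by simp [hx, h], by simp⟩

theorem sortPosition_injOn {n : ℕ} {f : ℕ → ℕ} (hf : ∀ x < n, ∀ y < n, f x = f y → x = y) :
    ∀ x < n, ∀ y < n, sortPosition n f x = sortPosition n f y → x = y := by
  intro x hx y hy h
  rcases lt_trichotomy (f x) (f y) with hlt | heq | hlt
  · exact absurd h (sortPosition_lt_sortPosition hx hlt).ne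
  · exact hf x hx y hy heq
  · exact absurd h (sortPosition_lt_sortPosition hy hlt).ne'

/-- The arrival order in which the items arrive by increasing `f`. -/
noncomputable def sortPerm (n : ℕ) (f : ℕ → ℕ) (hf : ∀ x < n, ∀ y < n, f x = f y → x = y) :
    Equiv.Perm (Fin n) :=
  (Equiv.ofBijective (fun x : Fin n => (⟨sortPosition n f x, sortPosition_lt f x.2⟩ : Fin n))
    (Finite.injective_iff_bijective.1 fun x y h => Fin.ext
      (sortPosition_injOn hf x x.2 y y.2 (congrArg Fin.val h)))).symm

theorem sortPerm_symm_val {n : ℕ} {f : ℕ → ℕ} (hf : ∀ x < n, ∀ y < n, f x = f y → x = y)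
    (x : Fin n) : (((sortPerm n f hf).symm x : Fin n) : ℕ) = sortPosition n f x := rfl

/-- The Reed–Solomon hash: the polynomial whose coefficients are the base-`q` digits of `x`,
evaluated at `u` modulo `q`. -/
def rsHash (q u x : ℕ) : ℕ := Nat.ofDigits u (Nat.digits q x) % q

theorem rsHash_zero (q u : ℕ) : rsHash q u 0 = 0 := by simp [rsHash]

theorem rsHash_eq {q : ℕ} (hq : 2 ≤ q) (u x : ℕ) :
    rsHash q u x = (rsHash q u (x / q) * u + x) % q := by
  rcases Nat.eq_zero_or_pos x with rfl | hx
  · simp [rsHash_zero]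
  · unfold rsHash
    rw [Nat.digits_def' (by omega) hx, Nat.ofDigits_cons]
    rw [Nat.add_comm, Nat.mul_comm u]
    exact Nat.ModEq.add ((Nat.mod_modEq _ _).symm.mul_right _) (Nat.mod_modEq _ _)

/-- The label of the item `x` under the seed `s < q ^ 4`: with base-`q` digits `u, α, β, γ` of `s`
and `h` the Reed–Solomon hash of `x` at `u`, it is `α h² + β h + γ` modulo `q`. -/
def seedLabel (q s x : ℕ) : ℕ :=
  ((s / q % q * rsHash q (s % q) x + s / q / q % q) * rsHash q (s % q) x + s / q / q / q) % q

/-- The sorting key: items are sorted by their labels, and items of the same label by index. -/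
def seedKey (n q s x : ℕ) : ℕ := seedLabel q s x * n + x

theorem seedKey_inj (n q s : ℕ) :
    ∀ x < n, ∀ y < n, seedKey n q s x = seedKey n q s y → x = y := by
  intro x hx y hy h
  have := congrArg (· % n) h
  simpa [seedKey, Nat.mod_eq_of_lt hx, Nat.mod_eq_of_lt hy] using this

theorem seedLabel_lt {q : ℕ} (hq : 0 < q) (s x : ℕ) : seedLabel q s x < q := Nat.mod_lt _ hq

theorem seedKey_le {n q x : ℕ} (hq : 0 < q) (s : ℕ) (hx : x < n) : seedKey n q s x ≤ q * n := by
  have h := Nat.mul_le_mul_right n (Nat.succ_le_of_lt (seedLabel_lt hq s x))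
  rw [Nat.succ_mul] at h
  unfold seedKey
  omega

/-- The arrival order given by the seed `s`. -/
noncomputable def seedPerm (n q s : ℕ) : Equiv.Perm (Fin n) :=
  sortPerm n (seedKey n q s) (seedKey_inj n q s)

/-- The arrival orders given by all seeds. -/
noncomputable def seedPerms (n q : ℕ) : List (Equiv.Perm (Fin n)) :=
  (List.range (q ^ 4)).map (seedPerm n q)

/-- The least prime greater than `a`. -/
noncomputable def nextPrime (a : ℕ) : ℕ := by
  classical exact Nat.find (Nat.exists_infinite_primes (a + 1))

theorem lt_nextPrime (a : ℕ) : a < nextPrime a := by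
  classical exact (Nat.find_spec (Nat.exists_infinite_primes (a + 1))).1

theorem prime_nextPrime (a : ℕ) : (nextPrime a).Prime := by
  classical exact (Nat.find_spec (Nat.exists_infinite_primes (a + 1))).2

theorem not_prime_of_lt_nextPrime {a b : ℕ} (h1 : a < b) (h2 : b < nextPrime a) : ¬ b.Prime := by
  classical exact fun hb => Nat.find_min (Nat.exists_infinite_primes (a + 1)) h2 ⟨h1, hb⟩

theorem nextPrime_le {a : ℕ} (ha : a ≠ 0) : nextPrime a ≤ 2 * a := by
  classical
  obtain ⟨p, hp, h1, h2⟩ := Nat.exists_prime_lt_and_le_two_mul a ha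
  exact (Nat.find_min' (Nat.exists_infinite_primes (a + 1)) ⟨h1, hp⟩).trans h2

namespace Ram

/-- The variable `a`: cell `0` of array `a`. -/
abbrev var (a : ℕ) : Expr := Expr.cell a (Expr.const 0)

/-- The assignment of the value of `e` to the variable `a`. -/
abbrev setVar (a : ℕ) (e : Expr) : Prog := Prog.assign a (Expr.const 0) e

open Ram.Expr Ram.Prog

/-- Puts the bit length of variable `0` into variable `2`; the working variable is `3`. -/
def sizeProg : Prog :=
  seq (setVar 3 (var 0)) (loop (var 3)
    (seq (setVar 2 (add (var 2) (const 1))) (setVar 3 (div (var 3) (const 2)))))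

/-- Puts the least prime greater than `ℓ ^ 4` into variable `4`, where `ℓ` is in variable `2`.
A candidate is prime if and only if its least divisor `≥ 2`, found in variable `6`, is the candidate
itself; their difference is in variable `5`. -/
def primeProg : Prog :=
  seq (setVar 4 (mul (mul (mul (var 2) (var 2)) (var 2)) (var 2))) (seq (setVar 5 (const 1))
    (loop (var 5)
      (seq (setVar 4 (add (var 4) (const 1)))
        (seq (setVar 6 (const 2))
          (seq (loop (mod (var 4) (var 6)) (setVar 6 (add (var 6) (const 1))))
            (setVar 5 (sub (var 4) (var 6))))))))

/-- With `n, q, s` in the variables `0, 4, 7`, fills array `11` with the hashes of the items `x < n`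
and array `12` with their sorting keys.  The hash of `x` comes from that of `x / q`; for `x = 0`
this reads cell `0` of array `11`, which is always `0`. -/
def keyProg : Prog :=
  seq (setVar 8 (const 0)) (loop (sub (var 0) (var 8))
    (seq (assign 11 (var 8)
        (mod (add (mul (cell 11 (div (var 8) (var 4))) (mod (var 7) (var 4))) (var 8)) (var 4)))
      (seq (assign 12 (var 8) (add (mul (mod (add (mul (add
          (mul (mod (div (var 7) (var 4)) (var 4)) (cell 11 (var 8)))
          (mod (div (div (var 7) (var 4)) (var 4)) (var 4))) (cell 11 (var 8)))
          (div (div (div (var 7) (var 4)) (var 4)) (var 4))) (var 4)) (var 0)) (var 8)))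
        (setVar 8 (add (var 8) (const 1))))))

/-- Puts into variable `9` the number of smaller keys than that of the item in variable `8`.  The
truncated expression `1 - (1 - (a - b))` is `1` if `b < a`, and `0` otherwise. -/
def countProg : Prog :=
  seq (setVar 9 (const 0)) (seq (setVar 10 (const 0)) (loop (sub (var 0) (var 10))
    (seq (setVar 9 (add (var 9) (sub (const 1) (sub (const 1)
        (sub (cell 12 (var 8)) (cell 12 (var 10)))))))
      (setVar 10 (add (var 10) (const 1))))))

/-- Writes the table of the permutation with the number in variable `7` to the output. -/
def tableProg : Prog :=
  seq (setVar 8 (const 0)) (loop (sub (var 0) (var 8))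
    (seq countProg (seq (assign 1 (add (mul (var 7) (var 0)) (var 9)) (var 8))
      (setVar 8 (add (var 8) (const 1))))))

/-- Writes the tables of the permutations of all seeds, and then their number. -/
def seedsProg : Prog :=
  seq (seq (setVar 7 (const 0))
    (loop (sub (mul (mul (mul (var 4) (var 4)) (var 4)) (var 4)) (var 7))
      (seq keyProg (seq tableProg (setVar 7 (add (var 7) (const 1)))))))
    (setVar 0 (var 7))

/-- The program that computes the multi-set of permutations. -/
def permsProg : Prog := seq sizeProg (seq primeProg seedsProg)

variable {M n : ℕ}

theorem sizeProg_spec (hn : n ≤ M) :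
    Hoare M (fun s => Bounded M s ∧ s 0 0 = n ∧ s 2 0 = 0 ∧ s 11 0 = 0) sizeProg
      (fun s => Bounded M s ∧ s 0 0 = n ∧ s 2 0 = n.size ∧ s 11 0 = 0) := by
  have hsz : n.size ≤ M := (size_le_self n).trans hn
  refine Hoare.seq (R := fun s => Bounded M s ∧ s 0 0 = n ∧ s 2 0 = 0 ∧ s 11 0 = 0 ∧
    s 3 0 = n / 2 ^ 0) ?_ ?_
  · refine Hoare.assign ?_
    rintro s ⟨hb, h0, h2, h11⟩
    exact ⟨hb, hb.store (hb _ _) _ _, by simp [Expr.val, store_apply, *]⟩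
  · refine (Hoare.loop (N := n.size) (fun i s => Bounded M s ∧ s 0 0 = n ∧ s 2 0 = i ∧ s 11 0 = 0 ∧
      s 3 0 = n / 2 ^ i) hsz (fun i s h => h.1) ?_ ?_ ?_).weaken (fun s h => h)
      (fun s h => ⟨h.1, h.2.1, h.2.2.1, h.2.2.2.1⟩)
    · rintro i s hi ⟨hb, h0, h2, h11, h3⟩
      have : 2 ^ i ≤ n := Nat.lt_size.1 hi
      simpa [Expr.val, h3] using this
    · rintro s ⟨hb, h0, h2, h11, h3⟩
      have : n < 2 ^ n.size := Nat.lt_size_self n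
      simpa [Expr.val, h3] using this
    · intro i hi
      refine Hoare.seq (R := fun s => Bounded M s ∧ s 0 0 = n ∧ s 2 0 = i + 1 ∧ s 11 0 = 0 ∧
        s 3 0 = n / 2 ^ i) ?_ ?_
      · refine Hoare.assign ?_
        rintro s ⟨hb, h0, h2, h11, h3⟩
        refine ⟨hb, hb.store ?_ _ _, by simp [Expr.val, store_apply, *]⟩
        simp only [Expr.val, h2]; omega
      · refine Hoare.assign ?_
        rintro s ⟨hb, h0, h2, h11, h3⟩
        refine ⟨hb, hb.store ((Nat.div_le_self _ _).trans (hb _ _)) _ _, ?_⟩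
        simp [Expr.val, store_apply, *, pow_succ, Nat.div_div_eq_div_mul]

theorem minFac_search {a : ℕ} (ha : 2 ≤ a) (hM : a ≤ M) :
    Hoare M (fun s => Bounded M s ∧ s 0 0 = n ∧ s 11 0 = 0 ∧ s 4 0 = a ∧ s 6 0 = 2)
      (loop (mod (var 4) (var 6)) (setVar 6 (add (var 6) (const 1))))
      (fun s => Bounded M s ∧ s 0 0 = n ∧ s 11 0 = 0 ∧ s 4 0 = a ∧ s 6 0 = a.minFac) := by
  have hle : a.minFac ≤ a := Nat.minFac_le (by omega)
  have h2le : 2 ≤ a.minFac := (Nat.minFac_prime (by omega)).two_le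
  refine (Hoare.loop (N := a.minFac - 2) (fun i s => Bounded M s ∧ s 0 0 = n ∧ s 11 0 = 0 ∧
      s 4 0 = a ∧ s 6 0 = 2 + i) (by omega) (fun i s h => h.1) ?_ ?_ ?_).weaken (fun s h => h)
      (fun s h => ⟨h.1, h.2.1, h.2.2.1, h.2.2.2.1, h.2.2.2.2.trans (by omega)⟩)
  · rintro i s hi ⟨hb, h0, h11, h4, h6⟩
    simp only [Expr.val, h4, h6]
    intro h
    have := Nat.minFac_le_of_dvd (by omega) (Nat.dvd_of_mod_eq_zero h)
    omega
  · rintro s ⟨hb, h0, h11, h4, h6⟩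
    simp only [Expr.val, h4, h6]
    rw [Nat.add_sub_cancel' h2le]
    exact Nat.mod_eq_zero_of_dvd (Nat.minFac_dvd a)
  · intro i hi
    refine Hoare.assign ?_
    rintro s ⟨hb, h0, h11, h4, h6⟩
    refine ⟨hb, hb.store ?_ _ _, by simp [Expr.val, store_apply, *]; omega⟩
    simp only [Expr.val, h6]; omega

theorem primeProg_spec {ℓ : ℕ} (hℓ : ℓ ≠ 0) (hM : nextPrime (ℓ ^ 4) ≤ M) :
    Hoare M (fun s => Bounded M s ∧ s 0 0 = n ∧ s 2 0 = ℓ ∧ s 11 0 = 0) primeProg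
      (fun s => Bounded M s ∧ s 0 0 = n ∧ s 4 0 = nextPrime (ℓ ^ 4) ∧ s 11 0 = 0) := by
  have hlt := lt_nextPrime (ℓ ^ 4)
  have hpos : 0 < ℓ ^ 4 := by positivity
  refine Hoare.seq (R := fun s => Bounded M s ∧ s 0 0 = n ∧ s 4 0 = ℓ ^ 4 ∧ s 11 0 = 0) ?_
    (Hoare.seq (R := fun s => Bounded M s ∧ s 0 0 = n ∧ s 4 0 = ℓ ^ 4 + 0 ∧ s 11 0 = 0 ∧
      (s 5 0 = if 0 = 0 then 1 else ℓ ^ 4 + 0 - (ℓ ^ 4 + 0).minFac)) ?_ ?_)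
  · refine Hoare.assign ?_
    rintro s ⟨hb, h0, h2, h11⟩
    have e : s 2 0 * s 2 0 * s 2 0 * s 2 0 = ℓ ^ 4 := by rw [h2]; ring
    refine ⟨hb, hb.store ?_ _ _, by simp [Expr.val, store_apply, h0, h11, e]⟩
    simp only [Expr.val, e]; omega
  · refine Hoare.assign ?_
    rintro s ⟨hb, h0, h4, h11⟩
    refine ⟨hb, hb.store ?_ _ _, by simp [Expr.val, store_apply, *]⟩
    simp only [Expr.val]; omega
  · refine (Hoare.loop (N := nextPrime (ℓ ^ 4) - ℓ ^ 4) (fun i s => Bounded M s ∧ s 0 0 = n ∧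
      s 4 0 = ℓ ^ 4 + i ∧ s 11 0 = 0 ∧
      (s 5 0 = if i = 0 then 1 else ℓ ^ 4 + i - (ℓ ^ 4 + i).minFac)) (by omega)
      (fun i s h => h.1) ?_ ?_ ?_).weaken (fun s h => h)
      (fun s h => ⟨h.1, h.2.1, h.2.2.1.trans (by omega), h.2.2.2.1⟩)
    · rintro i s hi ⟨hb, h0, h4, h11, h5⟩
      simp only [Expr.val, h5]
      split_ifs with h
      · exact one_ne_zero
      · have hnp := not_prime_of_lt_nextPrime (a := ℓ ^ 4) (b := ℓ ^ 4 + i) (by omega) (by omega)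
        have h1 : (ℓ ^ 4 + i).minFac ≤ ℓ ^ 4 + i := Nat.minFac_le (by omega)
        have h2 : (ℓ ^ 4 + i).minFac ≠ ℓ ^ 4 + i := fun h =>
          hnp (Nat.prime_def_minFac.2 ⟨by omega, h⟩)
        omega
    · rintro s ⟨hb, h0, h4, h11, h5⟩
      simp only [Expr.val, h5]
      rw [if_neg (by omega), Nat.add_sub_cancel' hlt.le, (prime_nextPrime _).minFac_eq, Nat.sub_self]
    · intro i hi
      refine Hoare.seq (R := fun s => Bounded M s ∧ s 0 0 = n ∧ s 11 0 = 0 ∧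
        s 4 0 = ℓ ^ 4 + (i + 1)) ?_ (Hoare.seq (R := fun s => Bounded M s ∧ s 0 0 = n ∧
        s 11 0 = 0 ∧ s 4 0 = ℓ ^ 4 + (i + 1) ∧ s 6 0 = 2) ?_
        (Hoare.seq (minFac_search (by omega) (by omega)) ?_))
      · refine Hoare.assign ?_
        rintro s ⟨hb, h0, h4, h11, h5⟩
        refine ⟨hb, hb.store ?_ _ _, by simp [Expr.val, store_apply, *]; omega⟩
        simp only [Expr.val, h4]; omega
      · refine Hoare.assign ?_
        rintro s ⟨hb, h0, h11, h4⟩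
        refine ⟨hb, hb.store ?_ _ _, by simp [Expr.val, store_apply, *]⟩
        simp only [Expr.val]; omega
      · refine Hoare.assign ?_
        rintro s ⟨hb, h0, h11, h4, h6⟩
        refine ⟨hb, hb.store ((Nat.sub_le _ _).trans (hb _ _)) _ _, ?_⟩
        simp [Expr.val, store_apply, *]

/-- What holds while the tables are computed: `n` and `q` are in their variables, the hash of `0`
is right, and the tables of the first `i` permutations are in place. -/
def TablesInv (M n q i : ℕ) (s : State) : Prop :=
  Bounded M s ∧ s 0 0 = n ∧ s 4 0 = q ∧ s 11 0 = 0 ∧ s 7 0 = i ∧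
    ∀ j < i, ∀ x < n, s 1 (j * n + sortPosition n (seedKey n q j) x) = x

theorem keyProg_spec {q i : ℕ} (hq : 2 ≤ q) (hqM : q ≤ M) (hqn : q * n ≤ M) (hn : n ≤ M) :
    Hoare M (TablesInv M n q i) keyProg
      (fun s => TablesInv M n q i s ∧ ∀ x < n, s 12 x = seedKey n q i x) := by
  refine Hoare.seq (R := fun s => TablesInv M n q i s ∧ s 8 0 = 0 ∧
    ∀ x < 0, s 11 x = rsHash q (i % q) x ∧ s 12 x = seedKey n q i x) ?_ ?_
  · refine Hoare.assign ?_
    rintro s ⟨hb, h0, h4, h11, h7, ho⟩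
    refine ⟨hb, ⟨hb.store ?_ _ _, ?_⟩, ?_⟩
    · simp [Expr.val]
    · simpa [Expr.val, store_apply, *] using ho
    · simp [Expr.val, store_apply]
  refine (Hoare.loop (N := n) (fun y s => TablesInv M n q i s ∧ s 8 0 = y ∧
    ∀ x < y, s 11 x = rsHash q (i % q) x ∧ s 12 x = seedKey n q i x) hn (fun i s h => h.1.1)
    ?_ ?_ ?_).weaken (fun s h => h) (fun s h => ⟨h.1, fun x hx => (h.2.2 x hx).2⟩)
  · rintro y s hy ⟨⟨hb, h0, h4, h11, h7, ho⟩, h8, hk⟩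
    simp only [Expr.val, h0, h8]; omega
  · rintro s ⟨⟨hb, h0, h4, h11, h7, ho⟩, h8, hk⟩
    simp [Expr.val, h0, h8]
  intro y hy
  refine Hoare.seq (R := fun s => TablesInv M n q i s ∧ s 8 0 = y ∧
    s 11 y = rsHash q (i % q) y ∧
    ∀ x < y, s 11 x = rsHash q (i % q) x ∧ s 12 x = seedKey n q i x) ?_ (Hoare.seq
    (R := fun s => TablesInv M n q i s ∧ s 8 0 = y ∧
    ∀ x < y + 1, s 11 x = rsHash q (i % q) x ∧ s 12 x = seedKey n q i x) ?_ ?_)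
  · refine Hoare.assign ?_
    rintro s ⟨⟨hb, h0, h4, h11, h7, ho⟩, h8, hk⟩
    have hprev : s 11 (y / q) = rsHash q (i % q) (y / q) := by
      rcases Nat.eq_zero_or_pos y with rfl | hpos
      · simp [h11, rsHash_zero]
      · exact (hk _ (Nat.div_lt_self hpos (by omega))).1
    have hval : Expr.val s (mod (add (mul (cell 11 (div (var 8) (var 4))) (mod (var 7) (var 4)))
        (var 8)) (var 4)) = rsHash q (i % q) y := by
      simp only [Expr.val, h4, h7, h8, hprev]
      rw [← rsHash_eq hq]
    have hle : rsHash q (i % q) y ≤ M := ((Nat.mod_lt _ (by omega)).le).trans hqM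
    rw [hval]
    refine ⟨hb, ⟨hb.store hle _ _, ?_, ?_, ?_, ?_, ?_⟩, ?_, ?_, ?_⟩
    · simpa [store_apply] using h0
    · simpa [store_apply] using h4
    · simp only [Expr.val, store_apply, h8]
      rcases Nat.eq_zero_or_pos y with rfl | hpos
      · simp [rsHash_zero]
      · simp [hpos.ne, h11]
    · simpa [store_apply] using h7
    · simpa [store_apply] using ho
    · simpa [store_apply] using h8
    · simp [Expr.val, store_apply, h8]
    · intro x hx
      simp only [Expr.val, store_apply, h8]
      simpa [hx.ne] using hk x hx
  · refine Hoare.assign ?_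
    rintro s ⟨⟨hb, h0, h4, h11, h7, ho⟩, h8, hy11, hk⟩
    have hval : Expr.val s (add (mul (mod (add (mul (add
          (mul (mod (div (var 7) (var 4)) (var 4)) (cell 11 (var 8)))
          (mod (div (div (var 7) (var 4)) (var 4)) (var 4))) (cell 11 (var 8)))
          (div (div (div (var 7) (var 4)) (var 4)) (var 4))) (var 4)) (var 0)) (var 8)) =
        seedKey n q i y := by
      simp only [Expr.val, h0, h4, h7, h8, hy11]
      rfl
    rw [hval]
    refine ⟨hb, ⟨hb.store ?_ _ _, ?_, ?_, ?_, ?_, ?_⟩, ?_, ?_⟩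
    · exact (seedKey_le (by omega) i hy).trans hqn
    · simpa [store_apply] using h0
    · simpa [store_apply] using h4
    · simpa [store_apply] using h11
    · simpa [store_apply] using h7
    · simpa [store_apply] using ho
    · simpa [store_apply] using h8
    · intro x hx
      simp only [Expr.val, store_apply, h8]
      rcases Nat.lt_succ_iff_lt_or_eq.1 hx with h | rfl
      · simpa [h.ne] using hk x h
      · simpa using hy11
  · refine Hoare.assign ?_
    rintro s ⟨⟨hb, h0, h4, h11, h7, ho⟩, h8, hk⟩
    refine ⟨hb, ⟨hb.store ?_ _ _, ?_⟩, ?_⟩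
    · simp only [Expr.val, h8]; omega
    · simpa [Expr.val, store_apply, *] using ho
    · simpa [Expr.val, store_apply, *] using hk

theorem countProg_spec {q i y : ℕ} (hn : n ≤ M) {Out : ℕ → ℕ} :
    Hoare M (fun s => Bounded M s ∧ s 0 0 = n ∧ s 4 0 = q ∧ s 11 0 = 0 ∧ s 7 0 = i ∧ s 1 = Out ∧
        s 8 0 = y ∧ y < n ∧ ∀ x < n, s 12 x = seedKey n q i x) countProg
      (fun s => Bounded M s ∧ s 0 0 = n ∧ s 4 0 = q ∧ s 11 0 = 0 ∧ s 7 0 = i ∧ s 1 = Out ∧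
        s 8 0 = y ∧ (∀ x < n, s 12 x = seedKey n q i x) ∧
        s 9 0 = sortPosition n (seedKey n q i) y) := by
  by_cases hy : y < n
  swap
  · intro s hs
    exact absurd hs.2.2.2.2.2.2.2.1 hy
  refine Hoare.seq (R := fun s => Bounded M s ∧ s 0 0 = n ∧ s 4 0 = q ∧ s 11 0 = 0 ∧ s 7 0 = i ∧
    s 1 = Out ∧ s 8 0 = y ∧ (∀ x < n, s 12 x = seedKey n q i x) ∧ s 9 0 = 0) ?_
    (Hoare.seq (R := fun s => (Bounded M s ∧ s 0 0 = n ∧ s 4 0 = q ∧ s 11 0 = 0 ∧ s 7 0 = i ∧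
    s 1 = Out ∧ s 8 0 = y ∧ (∀ x < n, s 12 x = seedKey n q i x)) ∧
    s 9 0 = ((Finset.range 0).filter (seedKey n q i · < seedKey n q i y)).card ∧
    s 10 0 = 0) ?_ ?_)
  · refine Hoare.assign ?_
    rintro s ⟨hb, h0, h4, h11, h7, ho, h8, -, hk⟩
    refine ⟨hb, hb.store (by simp [Expr.val]) _ _, ?_⟩
    simp only [Expr.val, funext_iff, store_apply] at ho ⊢
    simpa [*] using hk
  · refine Hoare.assign ?_
    rintro s ⟨hb, h0, h4, h11, h7, ho, h8, hk, h9⟩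
    refine ⟨hb, ⟨hb.store (by simp [Expr.val]) _ _, ?_⟩, ?_⟩
    · simp only [Expr.val, funext_iff, store_apply] at ho ⊢
      simpa [*] using hk
    · simp [Expr.val, store_apply, h9]
  refine (Hoare.loop (N := n) (fun z s => (Bounded M s ∧ s 0 0 = n ∧ s 4 0 = q ∧ s 11 0 = 0 ∧
    s 7 0 = i ∧ s 1 = Out ∧ s 8 0 = y ∧ (∀ x < n, s 12 x = seedKey n q i x)) ∧
    s 9 0 = ((Finset.range z).filter (seedKey n q i · < seedKey n q i y)).card ∧
    s 10 0 = z) hn (fun i s h => h.1.1)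
    ?_ ?_ ?_).weaken (fun s h => h) (fun s h => ?_)
  · rintro z s hz ⟨⟨hb, h0, h4, h11, h7, ho, h8, hk⟩, h9, h10⟩
    simp only [Expr.val, h0, h10]; omega
  · rintro s ⟨⟨hb, h0, h4, h11, h7, ho, h8, hk⟩, h9, h10⟩
    simp [Expr.val, h0, h10]
  · intro z hz
    refine Hoare.seq (R := fun s => (Bounded M s ∧ s 0 0 = n ∧ s 4 0 = q ∧ s 11 0 = 0 ∧
      s 7 0 = i ∧ s 1 = Out ∧ s 8 0 = y ∧ (∀ x < n, s 12 x = seedKey n q i x)) ∧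
      s 9 0 = ((Finset.range (z + 1)).filter (seedKey n q i · < seedKey n q i y)).card ∧
      s 10 0 = z) ?_ ?_
    · refine Hoare.assign ?_
      rintro s ⟨⟨hb, h0, h4, h11, h7, ho, h8, hk⟩, h9, h10⟩
      have hval : s 9 0 + (1 - (1 - (s 12 (s 8 0) - s 12 (s 10 0)))) =
          ((Finset.range (z + 1)).filter (seedKey n q i · < seedKey n q i y)).card := by
        rw [h8, h10, hk y hy, hk z hz, h9, Finset.range_add_one, Finset.filter_insert]
        split_ifs with h
        · rw [Finset.card_insert_of_notMem (by simp)]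
          omega
        · omega
      refine ⟨hb, ⟨hb.store ?_ _ _, ?_⟩, ?_⟩
      · simp only [Expr.val, hval]
        refine (Finset.card_filter_le _ _).trans ?_
        rw [Finset.card_range]; omega
      · simp only [Expr.val, funext_iff, store_apply] at ho ⊢
        simpa [*] using hk
      · simp only [Expr.val, store_apply, hval]
        simpa using h10
    · refine Hoare.assign ?_
      rintro s ⟨⟨hb, h0, h4, h11, h7, ho, h8, hk⟩, h9, h10⟩
      refine ⟨hb, ⟨hb.store ?_ _ _, ?_⟩, ?_⟩
      · simp only [Expr.val, h10]; omega
      · simp only [Expr.val, funext_iff, store_apply] at ho ⊢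
        simpa [*] using hk
      · simpa [Expr.val, store_apply, h10] using h9
  · obtain ⟨⟨hb, h0, h4, h11, h7, ho, h8, hk⟩, h9, -⟩ := h
    exact ⟨hb, h0, h4, h11, h7, ho, h8, hk, h9⟩

theorem tableProg_spec {q i : ℕ} (hn : n ≤ M) :
    Hoare M (fun s => TablesInv M n q i s ∧ ∀ x < n, s 12 x = seedKey n q i x) tableProg
      (fun s => TablesInv M n q i s ∧
        ∀ x < n, s 1 (i * n + sortPosition n (seedKey n q i) x) = x) := by
  refine Hoare.seq (R := fun s => TablesInv M n q i s ∧ (∀ x < n, s 12 x = seedKey n q i x) ∧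
    s 8 0 = 0 ∧ ∀ x < 0, s 1 (i * n + sortPosition n (seedKey n q i) x) = x) ?_ ?_
  · refine Hoare.assign ?_
    rintro s ⟨⟨hb, h0, h4, h11, h7, ho⟩, hk⟩
    refine ⟨hb, ⟨hb.store (by simp [Expr.val]) _ _, ?_⟩, ?_⟩
    · simpa [Expr.val, store_apply, *] using ho
    · simpa [Expr.val, store_apply] using hk
  refine (Hoare.loop (N := n) (fun y s => TablesInv M n q i s ∧
    (∀ x < n, s 12 x = seedKey n q i x) ∧ s 8 0 = y ∧
    ∀ x < y, s 1 (i * n + sortPosition n (seedKey n q i) x) = x) hn (fun i s h => h.1.1)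
    ?_ ?_ ?_).weaken (fun s h => h) (fun s h => ⟨h.1, h.2.2.2⟩)
  · rintro y s hy ⟨⟨hb, h0, h4, h11, h7, ho⟩, hk, h8, -⟩
    simp only [Expr.val, h0, h8]; omega
  · rintro s ⟨⟨hb, h0, h4, h11, h7, ho⟩, hk, h8, -⟩
    simp [Expr.val, h0, h8]
  intro y hy s₀ hs₀
  -- The output array before the iteration is fixed, because `countProg` does not change it.
  obtain ⟨hT₀, hk₀, h8₀, hout₀⟩ := hs₀
  have hT₀' := hT₀
  obtain ⟨hb₀, h0₀, h4₀, h11₀, h7₀, ho₀⟩ := hT₀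
  have hposy := sortPosition_lt (seedKey n q i) hy
  refine (Hoare.seq (countProg_spec (q := q) (i := i) (y := y) (Out := s₀ 1) hn)
    (Hoare.seq (R := fun s => TablesInv M n q i s ∧ (∀ x < n, s 12 x = seedKey n q i x) ∧
      s 8 0 = y ∧ ∀ x < y + 1, s 1 (i * n + sortPosition n (seedKey n q i) x) = x) ?_ ?_)) s₀
    ⟨hb₀, h0₀, h4₀, h11₀, h7₀, rfl, h8₀, hy, hk₀⟩
  · refine Hoare.assign ?_
    rintro s ⟨hb, h0, h4, h11, h7, ho, h8, hk, h9⟩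
    refine ⟨hb, ⟨hb.store (hb _ _) _ _, ?_, ?_, ?_, ?_, ?_⟩, ?_, ?_, ?_⟩
    · simpa [store_apply] using h0
    · simpa [store_apply] using h4
    · simpa [store_apply] using h11
    · simpa [store_apply] using h7
    · intro j hj x hx
      have hposx := sortPosition_lt (seedKey n q j) hx
      have hlt : (j + 1) * n ≤ i * n := Nat.mul_le_mul_right _ hj
      rw [Nat.succ_mul] at hlt
      simp only [Expr.val, store_apply, h0, h7, h9, h8]
      rw [if_neg (by omega), ho]
      exact ho₀ j hj x hx
    · simpa [store_apply] using hk
    · simpa [store_apply] using h8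
    · intro x hx
      simp only [Expr.val, store_apply, h0, h7, h9, h8]
      rcases Nat.lt_succ_iff_lt_or_eq.1 hx with h | rfl
      · have hne : sortPosition n (seedKey n q i) x ≠ sortPosition n (seedKey n q i) y :=
          fun h' => h.ne (sortPosition_injOn (seedKey_inj n q i) x (by omega) y hy h')
        rw [if_neg (by omega), ho]
        exact hout₀ x h
      · simp
  · refine Hoare.assign ?_
    rintro s ⟨⟨hb, h0, h4, h11, h7, ho⟩, hk, h8, hout⟩
    refine ⟨hb, ⟨hb.store ?_ _ _, ?_⟩, ?_⟩
    · simp only [Expr.val, h8]; omega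
    · simpa [Expr.val, store_apply, *] using ho
    · refine ⟨?_, ?_, ?_⟩
      · simpa [Expr.val, store_apply] using hk
      · simp [Expr.val, store_apply, h8]
      · simpa [Expr.val, store_apply] using hout

theorem seedsProg_spec {q : ℕ} (hq : 2 ≤ q) (hqM : q ^ 4 ≤ M) (hqn : q * n ≤ M) (hn : n ≤ M) :
    Hoare M (fun s => Bounded M s ∧ s 0 0 = n ∧ s 4 0 = q ∧ s 11 0 = 0) seedsProg
      (fun s => s 0 0 = q ^ 4 ∧
        ∀ j < q ^ 4, ∀ x < n, s 1 (j * n + sortPosition n (seedKey n q j) x) = x) := by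
  have hqM' : q ≤ M := (Nat.le_self_pow (by norm_num) q).trans hqM
  refine Hoare.seq (R := TablesInv M n q (q ^ 4)) (Hoare.seq (R := TablesInv M n q 0) ?_ ?_) ?_
  · refine Hoare.assign ?_
    rintro s ⟨hb, h0, h4, h11⟩
    exact ⟨hb, hb.store (by simp [Expr.val]) _ _, by simp [Expr.val, store_apply, *]⟩
  · refine Hoare.loop (N := q ^ 4) (TablesInv M n q) hqM (fun i s h => h.1) ?_ ?_ ?_
    · rintro i s hi ⟨hb, h0, h4, h11, h7, ho⟩
      have : q * q * q * q = q ^ 4 := by ring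
      simp only [Expr.val, h4, h7]
      omega
    · rintro s ⟨hb, h0, h4, h11, h7, ho⟩
      have : q * q * q * q = q ^ 4 := by ring
      simp only [Expr.val, h4, h7]
      omega
    · intro i hi
      refine Hoare.seq (keyProg_spec hq hqM' hqn hn) (Hoare.seq (tableProg_spec hn) ?_)
      refine Hoare.assign ?_
      rintro s ⟨⟨hb, h0, h4, h11, h7, ho⟩, hout⟩
      refine ⟨hb, hb.store ?_ _ _, ?_⟩
      · simp only [Expr.val, h7]; omega
      · refine ⟨?_, ?_, ?_, ?_, ?_⟩
        · simpa [store_apply] using h0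
        · simpa [store_apply] using h4
        · simpa [store_apply] using h11
        · simp [Expr.val, store_apply, h7]
        · intro j hj x hx
          rcases Nat.lt_succ_iff_lt_or_eq.1 hj with h | rfl
          · simpa [Expr.val, store_apply] using ho j h x hx
          · simpa [Expr.val, store_apply] using hout x hx
  · refine Hoare.assign ?_
    rintro s ⟨hb, h0, h4, h11, h7, ho⟩
    refine ⟨hb, ?_, ?_⟩
    · simp [Expr.val, store_apply, h7]
    · simpa [Expr.val, store_apply] using ho

theorem outputs_seedPerms {q : ℕ} {s : State} (h0 : s 0 0 = q ^ 4)
    (h : ∀ j < q ^ 4, ∀ x < n, s 1 (j * n + sortPosition n (seedKey n q j) x) = x) :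
    Outputs s (seedPerms n q) := by
  refine ⟨by simp [seedPerms, h0], fun j p => ?_⟩
  have hj : (j : ℕ) < q ^ 4 := by simpa [seedPerms] using j.2
  have hget : (seedPerms n q).get j = seedPerm n q j := by
    rw [List.get_eq_getElem]
    simp [seedPerms]
  rw [hget]
  have := h j hj (seedPerm n q j p) (Fin.is_lt _)
  rwa [← sortPerm_symm_val (seedKey_inj n q j), show sortPerm n (seedKey n q j) _ = seedPerm n q j
    from rfl, Equiv.symm_apply_apply] at this

/-- A polynomial in `n` that bounds all numbers stored by `permsProg`. -/
noncomputable def cellPoly : Polynomial ℕ :=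
  Polynomial.C 16 * Polynomial.X ^ 16 + Polynomial.C 2 * Polynomial.X ^ 5 + Polynomial.X

theorem permsProg_spec {k : ℕ} (hn : n ≠ 0) (hk : k ≤ n) :
    ∃ t s, Exec permsProg (input n k) t s ∧ t ≤ (permsProg.costPoly.comp cellPoly).eval n ∧
      Outputs s (seedPerms n (nextPrime (n.size ^ 4))) := by
  set q := nextPrime (n.size ^ 4) with hqdef
  set M := cellPoly.eval n with hM
  have hM' : M = 16 * n ^ 16 + 2 * n ^ 5 + n := by simp [hM, cellPoly]
  have hsz : n.size ≠ 0 := by simpa [Nat.size_eq_zero] using hn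
  have hq : q ≤ 2 * n ^ 4 := (nextPrime_le (pow_ne_zero _ hsz)).trans
    (Nat.mul_le_mul_left _ (Nat.pow_le_pow_left (size_le_self n) 4))
  have hq4 : q ^ 4 ≤ 16 * n ^ 16 := (Nat.pow_le_pow_left hq 4).trans (by ring_nf; rfl)
  have hqn : q * n ≤ 2 * n ^ 5 := (Nat.mul_le_mul_right n hq).trans (by ring_nf; rfl)
  have hqq : q ≤ q ^ 4 := Nat.le_self_pow (by norm_num) q
  have hqM : q ≤ M := by omega
  have hq4M : q ^ 4 ≤ M := by omega
  have hqnM : q * n ≤ M := by omega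
  have hin : Bounded M (input n k) := by
    intro a i
    simp only [input, store_apply]
    split_ifs <;> omega
  obtain ⟨t, s, h1, h2, h3⟩ := (Hoare.seq (sizeProg_spec (M := M) (n := n) (by omega))
    (Hoare.seq (primeProg_spec hsz hqM) (seedsProg_spec (prime_nextPrime _).two_le
      hq4M hqnM (by omega)))) (input n k) ⟨hin, by simp [input, store_apply]⟩
  refine ⟨t, s, h1, ?_, outputs_seedPerms h3.1 h3.2⟩
  rw [Polynomial.eval_comp]
  exact h2

end Ram

/-! ### Random quadratic polynomials over a prime field -/

section Quadratic

variable {q : ℕ} [Fact q.Prime]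

/-- The value at `z` of the polynomial with the coefficients `g = (α, β, γ)`. -/
def quadEval (g : ZMod q × ZMod q × ZMod q) (z : ZMod q) : ZMod q := (g.1 * z + g.2.1) * z + g.2.2

/-- Interpolation: the values at three points determine a quadratic polynomial. -/
theorem quadEval_bijective {z₁ z₂ z₃ : ZMod q} (h₁₂ : z₁ ≠ z₂) (h₁₃ : z₁ ≠ z₃) (h₂₃ : z₂ ≠ z₃) :
    Function.Bijective fun g : ZMod q × ZMod q × ZMod q =>
      (quadEval g z₁, quadEval g z₂, quadEval g z₃) := by
  refine Finite.injective_iff_bijective.1 ?_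
  rintro ⟨a, b, c⟩ ⟨a', b', c'⟩ h
  simp only [quadEval, Prod.mk.injEq] at h
  obtain ⟨h1, h2, h3⟩ := h
  have e12 : (a - a') * (z₁ + z₂) + (b - b') = 0 :=
    mul_left_cancel₀ (sub_ne_zero.2 h₁₂) (by linear_combination h1 - h2)
  have e13 : (a - a') * (z₁ + z₃) + (b - b') = 0 :=
    mul_left_cancel₀ (sub_ne_zero.2 h₁₃) (by linear_combination h1 - h3)
  have ea : a - a' = 0 :=
    mul_left_cancel₀ (sub_ne_zero.2 h₂₃) (by linear_combination e12 - e13)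
  have eb : b - b' = 0 := by linear_combination e12 - (z₁ + z₂) * ea
  have ec : c - c' = 0 := by linear_combination h1 - z₁ * z₁ * ea - z₁ * eb
  rw [sub_eq_zero.1 ea, sub_eq_zero.1 eb, sub_eq_zero.1 ec]

/-- The values of a random quadratic polynomial at three points are independent and uniform. -/
theorem sum_quadEval_mul {z₁ z₂ z₃ : ZMod q} (h₁₂ : z₁ ≠ z₂) (h₁₃ : z₁ ≠ z₃) (h₂₃ : z₂ ≠ z₃)
    (f₁ f₂ f₃ : ZMod q → ℝ) :
    ∑ g, f₁ (quadEval g z₁) * (f₂ (quadEval g z₂) * f₃ (quadEval g z₃)) =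
      (∑ y, f₁ y) * ((∑ y, f₂ y) * ∑ y, f₃ y) := by
  rw [(quadEval_bijective h₁₂ h₁₃ h₂₃).sum_comp
    (fun y : ZMod q × ZMod q × ZMod q => f₁ y.1 * (f₂ y.2.1 * f₃ y.2.2)),
    Finset.sum_mul, Fintype.sum_prod_type]
  refine Finset.sum_congr rfl fun y₁ _ => ?_
  rw [Fintype.sum_prod_type, Finset.sum_mul_sum, Finset.mul_sum]
  simp_rw [Finset.mul_sum]

theorem sum_quadEval_mul_two (hq : 3 ≤ q) {z₁ z₂ : ZMod q} (h₁₂ : z₁ ≠ z₂) (f₁ f₂ : ZMod q → ℝ) :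
    ∑ g, f₁ (quadEval g z₁) * f₂ (quadEval g z₂) = q * ((∑ y, f₁ y) * ∑ y, f₂ y) := by
  obtain ⟨z₃, hz₃⟩ : ∃ z₃ : ZMod q, z₃ ∉ ({z₁, z₂} : Finset (ZMod q)) := by
    by_contra! h
    have h1 := Finset.card_le_card (fun z _ => h z : (Finset.univ : Finset (ZMod q)) ⊆ {z₁, z₂})
    have h2 := Finset.card_le_two (a := z₁) (b := z₂)
    rw [Finset.card_univ, ZMod.card] at h1
    omega
  simp only [Finset.mem_insert, Finset.mem_singleton, not_or] at hz₃
  have := sum_quadEval_mul h₁₂ (Ne.symm hz₃.1) (Ne.symm hz₃.2) f₁ f₂ (fun _ => 1)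
  simp only [mul_one, Finset.sum_const, Finset.card_univ, ZMod.card, nsmul_eq_mul] at this
  rw [this]; ring

theorem card_val_lt {c : ℕ} (hc : c ≤ q) :
    ((Finset.univ : Finset (ZMod q)).filter (·.val < c)).card = c := by
  have h : ((Finset.univ : Finset (ZMod q)).filter (·.val < c)).image ZMod.val =
      Finset.range c := by
    ext x
    simp only [Finset.mem_image, Finset.mem_filter, Finset.mem_univ, true_and, Finset.mem_range]
    constructor
    · rintro ⟨y, hy, rfl⟩; exact hy
    · intro hx
      have : (x : ZMod q).val = x := ZMod.val_cast_of_lt (hx.trans_le hc)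
      exact ⟨x, by rwa [this], this⟩
  rw [← Finset.card_image_of_injective _ (ZMod.val_injective q), h, Finset.card_range]

/-- The number of points of `J` at which the polynomial `g` has a value below `c`. -/
def lowCount (J : Finset (ZMod q)) (c : ℕ) (g : ZMod q × ZMod q × ZMod q) : ℕ :=
  (J.filter fun z => (quadEval g z).val < c).card

/-- Chebyshev's inequality for the number of points of `J` with a value below `c`, conditional on
the value at a point `z₀` outside `J`; given this value, the others are pairwise independent. -/
theorem lowCount_chebyshev (hq : 3 ≤ q) {z₀ : ZMod q} (y₀ : ZMod q) {J : Finset (ZMod q)}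
    (hJ : z₀ ∉ J) {c : ℕ} (hc : c ≤ q) {t : ℝ} (ht : 0 ≤ t) :
    ((Finset.univ.filter fun g : ZMod q × ZMod q × ZMod q =>
      quadEval g z₀ = y₀ ∧ t ≤ |(lowCount J c g : ℝ) - J.card * (c / q)|).card : ℝ) * t ^ 2 ≤
      J.card * (q * c) := by
  have hq0 : (q : ℝ) ≠ 0 := by positivity
  set e : ZMod q → ℝ := fun y => (if y.val < c then 1 else 0) - c / q with he
  set d : ZMod q → ℝ := fun y => if y = y₀ then 1 else 0 with hd
  have hd1 : ∑ y, d y = 1 := by simp [hd]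
  have hcard : ∑ y : ZMod q, (if y.val < c then (1 : ℝ) else 0) = c := by
    rw [Finset.sum_boole, card_val_lt hc]
  have he0 : ∑ y, e y = 0 := by
    simp only [he, Finset.sum_sub_distrib, hcard, Finset.sum_const, Finset.card_univ, ZMod.card,
      nsmul_eq_mul]
    field_simp
    ring
  have he2 : ∑ y, e y * e y ≤ c := by
    have h1 : ∀ y, e y * e y = (if y.val < c then 1 else 0) - 2 * (c / q) *
        (if y.val < c then 1 else 0) + (c / q) ^ 2 := by
      intro y; simp only [he]; split_ifs <;> ring
    simp only [h1, Finset.sum_add_distrib, Finset.sum_sub_distrib, ← Finset.mul_sum, hcard,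
      Finset.sum_const, Finset.card_univ, ZMod.card, nsmul_eq_mul]
    have : (0 : ℝ) ≤ c ^ 2 / q := by positivity
    have h2 : (c : ℝ) - 2 * (c / q) * c + q * (c / q) ^ 2 = c - c ^ 2 / q := by
      field_simp; ring
    linarith
  have hcount : ∀ g, (lowCount J c g : ℝ) - J.card * (c / q) = ∑ z ∈ J, e (quadEval g z) := by
    intro g
    simp only [he, Finset.sum_sub_distrib, Finset.sum_boole, Finset.sum_const, nsmul_eq_mul,
      lowCount]
  have hvar : ∑ g, d (quadEval g z₀) * (∑ z ∈ J, e (quadEval g z)) ^ 2 ≤ J.card * (q * c) := by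
    have h1 : ∀ g, d (quadEval g z₀) * (∑ z ∈ J, e (quadEval g z)) ^ 2 =
        ∑ z ∈ J, ∑ z' ∈ J, d (quadEval g z₀) * (e (quadEval g z) * e (quadEval g z')) := by
      intro g
      rw [pow_two, Finset.sum_mul_sum]
      simp_rw [Finset.mul_sum]
    simp_rw [h1]
    rw [Finset.sum_comm, ← nsmul_eq_mul]
    refine Finset.sum_le_card_nsmul _ _ _ fun z hz => ?_
    have hz0 : z₀ ≠ z := fun h => hJ (h ▸ hz)
    rw [Finset.sum_comm, Finset.sum_eq_single_of_mem z hz]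
    · rw [sum_quadEval_mul_two hq hz0 d (fun y => e y * e y), hd1, one_mul]
      exact mul_le_mul_of_nonneg_left he2 (by positivity)
    · intro z' hz' hne
      rw [sum_quadEval_mul hz0 (fun h => hJ (h ▸ hz')) hne.symm, he0, zero_mul, mul_zero]
  refine le_trans ?_ hvar
  rw [Finset.card_filter, Nat.cast_sum, Finset.sum_mul]
  refine Finset.sum_le_sum fun g _ => ?_
  rw [hcount]
  by_cases hg : quadEval g z₀ = y₀
  · simp only [hd, hg, true_and, if_true, one_mul]
    split_ifs with h
    · rw [← sq_abs (∑ z ∈ J, e (quadEval g z))]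
      simpa using pow_le_pow_left₀ ht h 2
    · simp; positivity
  · simp [hd, hg]

end Quadratic

/-! ### The Reed–Solomon hash and the seeds -/

section Hash

variable {q : ℕ} [Fact q.Prime]

open Polynomial in
/-- The polynomial over `ℤ/q` whose coefficients are the base-`q` digits of `x`. -/
noncomputable def digitPoly (q x : ℕ) : (ZMod q)[X] := Nat.ofDigits X (Nat.digits q x)

theorem digitPoly_zero (q : ℕ) : digitPoly q 0 = 0 := by
  simp [digitPoly, Nat.ofDigits]

open Polynomial in
theorem digitPoly_eq (x : ℕ) :
    digitPoly q x = C (x : ZMod q) + X * digitPoly q (x / q) := by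
  have hq : 1 < q := (Fact.out : q.Prime).one_lt
  rcases Nat.eq_zero_or_pos x with rfl | hx
  · simp [digitPoly_zero]
  · conv_lhs => rw [digitPoly, Nat.digits_def' hq hx, Nat.ofDigits]
    have h : ((x % q : ℕ) : (ZMod q)[X]) = C (x : ZMod q) := by
      rw [← Polynomial.C_eq_natCast, ZMod.natCast_mod]
    rw [h]
    rfl

open Polynomial in
theorem eval_digitPoly (u : ZMod q) (x : ℕ) :
    (digitPoly q x).eval u = (rsHash q u.val x : ZMod q) := by
  rw [rsHash, ZMod.natCast_mod, digitPoly]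
  induction Nat.digits q x with
  | nil => simp [Nat.ofDigits]
  | cons a l ih => simpa [Nat.ofDigits] using Or.inl ih

open Polynomial in
theorem degree_digitPoly_lt {x L : ℕ} (hx : x < q ^ L) : (digitPoly q x).degree < L := by
  induction L generalizing x with
  | zero =>
    obtain rfl : x = 0 := by simpa using hx
    simp [digitPoly_zero]
  | succ L ih =>
    have h1 := ih (x := x / q) (Nat.div_lt_of_lt_mul (by rwa [pow_succ, mul_comm] at hx))
    rw [digitPoly_eq]
    refine lt_of_le_of_lt (degree_add_le _ _) (max_lt (degree_C_le.trans_lt ?_) ?_)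
    · exact_mod_cast Nat.succ_pos L
    · rw [degree_mul, degree_X, add_comm]
      rcases eq_or_ne (digitPoly q (x / q)) 0 with h | h
      · simp [h]
      · rw [degree_eq_natDegree h] at h1 ⊢
        exact_mod_cast Nat.succ_lt_succ (by exact_mod_cast h1)

open Polynomial in
theorem digitPoly_injective : Function.Injective (digitPoly q) := by
  have hq : 1 < q := (Fact.out : q.Prime).one_lt
  intro x
  induction x using Nat.strong_induction_on with
  | _ x ih =>
    intro y h
    have h0 := h
    rw [digitPoly_eq x, digitPoly_eq y] at h0
    have hc : (x : ZMod q) = y := by simpa using congrArg (fun p => p.coeff 0) h0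
    have hd : digitPoly q (x / q) = digitPoly q (y / q) := by
      rw [hc] at h0
      exact mul_left_cancel₀ X_ne_zero (add_left_cancel h0)
    have hmod : x % q = y % q := (ZMod.natCast_eq_natCast_iff' x y q).1 hc
    have hdiv : x / q = y / q := by
      rcases Nat.eq_zero_or_pos x with rfl | hx
      · -- For `x = 0` the induction hypothesis says nothing about `x / q = x`.
        rw [Nat.zero_div] at hd ⊢
        by_contra hne
        have hy : ∀ z, z ≠ 0 → digitPoly q z ≠ 0 := by
          intro z
          induction z using Nat.strong_induction_on with
          | _ z ihz =>
            intro hz hz0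
            rw [digitPoly_eq] at hz0
            have hz1 : (z : ZMod q) = 0 := by simpa using congrArg (fun p => p.coeff 0) hz0
            rw [hz1, map_zero, zero_add, mul_eq_zero, or_iff_right X_ne_zero] at hz0
            have hdvd := (ZMod.natCast_eq_zero_iff z q).1 hz1
            have hle := Nat.le_of_dvd (Nat.pos_of_ne_zero hz) hdvd
            exact ihz _ (Nat.div_lt_self (Nat.pos_of_ne_zero hz) hq)
              (Nat.div_pos hle (by omega)).ne' hz0
        exact hy _ (Ne.symm hne) (by rw [← hd, digitPoly_zero])
      · exact ih _ (Nat.div_lt_self hx hq) hd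
    rw [← Nat.div_add_mod x q, ← Nat.div_add_mod y q, hmod, hdiv]

/-- Two items collide for at most `L` of the `q` evaluation points, because two distinct polynomials
of degree less than `L` agree at fewer than `L` points. -/
theorem card_collision_le {x y L : ℕ} (hx : x < q ^ L) (hy : y < q ^ L) (hxy : x ≠ y) :
    ((Finset.univ : Finset (ZMod q)).filter fun u =>
      (rsHash q u.val x : ZMod q) = rsHash q u.val y).card ≤ L := by
  have hne : digitPoly q x - digitPoly q y ≠ 0 :=
    sub_ne_zero.2 fun h => hxy (digitPoly_injective h)
  have hdeg : (digitPoly q x - digitPoly q y).natDegree ≤ L := by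
    refine Polynomial.natDegree_le_of_degree_le ((Polynomial.degree_sub_le _ _).trans ?_)
    exact max_le (degree_digitPoly_lt hx).le (degree_digitPoly_lt hy).le
  refine le_trans (le_trans (Finset.card_le_card ?_) (Multiset.toFinset_card_le _))
    ((Polynomial.card_roots' (digitPoly q x - digitPoly q y)).trans hdeg)
  intro u hu
  rw [Finset.mem_filter, ← eval_digitPoly, ← eval_digitPoly] at hu
  simp [Polynomial.mem_roots hne, Polynomial.IsRoot, hu.2]

theorem cast_rsHash_eq (u x : ℕ) :
    (rsHash q u x : ZMod q) = rsHash q u (x / q) * u + x := by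
  rw [rsHash_eq (Fact.out : q.Prime).two_le, ZMod.natCast_mod]
  push_cast
  rfl

/-- No hash is much more frequent than the others: among `q` consecutive items, starting at a
multiple of `q`, each hash occurs once. -/
theorem card_rsHash_eq_le (n u : ℕ) (z : ZMod q) :
    ((Finset.range n).filter fun x => (rsHash q u x : ZMod q) = z).card ≤ n / q + 1 := by
  rw [← Finset.card_range (n / q + 1)]
  refine Finset.card_le_card_of_injOn (· / q) ?_ ?_
  · intro x hx
    simp only [Finset.coe_filter, Finset.mem_range, Set.mem_ofPred_eq] at hx
    simpa using Nat.lt_succ_of_le (Nat.div_le_div_right hx.1.le)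
  · intro x hx y hy hxy
    simp only [Finset.coe_filter, Finset.mem_range, Set.mem_ofPred_eq] at hx hy hxy
    have h := hx.2.trans hy.2.symm
    rw [cast_rsHash_eq, cast_rsHash_eq u y, hxy] at h
    have hmod : x % q = y % q := (ZMod.natCast_eq_natCast_iff' x y q).1 (add_left_cancel h)
    rw [← Nat.div_add_mod x q, ← Nat.div_add_mod y q, hmod, hxy]

/-- No hash is much less frequent than the others. -/
theorem le_card_rsHash_eq (n u : ℕ) (z : ZMod q) :
    n / q ≤ ((Finset.range n).filter fun x => (rsHash q u x : ZMod q) = z).card := by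
  have hq : 0 < q := (Fact.out : q.Prime).pos
  have hdiv : ∀ y, (q * y + (z - rsHash q u y * u : ZMod q).val) / q = y := fun y => by
    rw [Nat.mul_add_div hq, Nat.div_eq_of_lt (ZMod.val_lt _), add_zero]
  conv_lhs => rw [← Finset.card_range (n / q)]
  refine Finset.card_le_card_of_injOn
    (fun y => q * y + (z - rsHash q u y * u : ZMod q).val) ?_ ?_
  · intro y hy
    have hy' : y < n / q := by simpa using hy
    have h1 : q * (y + 1) ≤ n := by
      rw [mul_comm]; exact (Nat.le_div_iff_mul_le hq).1 hy'
    have h2 := ZMod.val_lt (z - rsHash q u y * u : ZMod q)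
    simp only [Finset.coe_filter, Finset.mem_range, Set.mem_ofPred_eq]
    refine ⟨by rw [Nat.mul_succ] at h1; omega, ?_⟩
    rw [cast_rsHash_eq, hdiv]
    push_cast
    rw [ZMod.natCast_self, ZMod.natCast_rightInverse]
    ring
  · intro x _ y _ hxy
    rw [← hdiv x, ← hdiv y]
    exact congrArg (· / q) hxy

theorem seedLabel_eq (s x : ℕ) :
    seedLabel q s x = (quadEval ((s / q : ℕ), ((s / q / q : ℕ), (s / q / q / q : ℕ)))
      (rsHash q (s : ZMod q).val x : ZMod q)).val := by
  rw [seedLabel, ← ZMod.val_natCast, ZMod.val_natCast q s]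
  congr 1
  simp [quadEval, ZMod.natCast_mod]

theorem sum_range_mul_mod_div (N : ℕ) (f : ZMod q → ℕ → ℝ) :
    ∑ s ∈ Finset.range (q * N), f s (s / q) = ∑ u, ∑ t ∈ Finset.range N, f u t := by
  have hq : 0 < q := (Fact.out : q.Prime).pos
  rw [← Finset.sum_product', eq_comm]
  refine Finset.sum_bij' (fun p _ => p.1.val + q * p.2) (fun s _ => ((s : ZMod q), s / q))
    ?_ ?_ ?_ ?_ ?_
  · rintro ⟨u, t⟩ h
    have ht : t < N := by simpa using h
    have := ZMod.val_lt u
    have h2 : q * (t + 1) ≤ q * N := Nat.mul_le_mul_left q ht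
    rw [Nat.mul_succ] at h2
    simp only [Finset.mem_range]; omega
  · intro s hs
    simp only [Finset.mem_range] at hs
    simpa using Nat.div_lt_of_lt_mul hs
  · rintro ⟨u, t⟩ _
    simp [Nat.add_mul_div_left _ _ hq, Nat.div_eq_of_lt (ZMod.val_lt u)]
  · intro s _
    simp [ZMod.val_natCast, Nat.mod_add_div]
  · rintro ⟨u, t⟩ _
    simp [Nat.add_mul_div_left _ _ hq, Nat.div_eq_of_lt (ZMod.val_lt u)]

theorem sum_range_natCast (f : ZMod q → ℝ) : ∑ s ∈ Finset.range q, f s = ∑ u, f u := by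
  have := sum_range_mul_mod_div (q := q) 1 (fun u _ => f u)
  simpa using this

/-- A sum over the seeds is a sum over the evaluation points and the quadratic polynomials. -/
theorem sum_seeds (f : ZMod q → ZMod q × ZMod q × ZMod q → ℝ) :
    ∑ s ∈ Finset.range (q ^ 4),
        f s ((s / q : ℕ), ((s / q / q : ℕ), (s / q / q / q : ℕ))) = ∑ u, ∑ g, f u g := by
  rw [show q ^ 4 = q * (q * (q * q)) by ring]
  rw [sum_range_mul_mod_div (q * (q * q)) fun u t => f u (t, ((t / q : ℕ), (t / q / q : ℕ)))]
  refine Finset.sum_congr rfl fun u _ => ?_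
  rw [sum_range_mul_mod_div (q * q) fun a t => f u (a, (t, (t / q : ℕ))), Fintype.sum_prod_type]
  refine Finset.sum_congr rfl fun a _ => ?_
  rw [sum_range_mul_mod_div q fun b t => f u (a, (b, t)), Fintype.sum_prod_type]
  exact Finset.sum_congr rfl fun b _ => sum_range_natCast fun c => f u (a, (b, c))

end Hash

/-! ### When the wait-and-pick algorithm selects an item -/

section Selection

variable {n : ℕ}

/-- If at least `τ` of the ranks below `R` are observed, then the `τ`-th best observed rank
exists. -/
theorem exists_card_observed_eq (A : Finset (Fin n)) {τ R : ℕ} (hτ : 1 ≤ τ)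
    (hR : τ ≤ (A.filter fun j : Fin n => (j : ℕ) < R).card) :
    ∃ t ∈ A, (A.filter fun j : Fin n => j ≤ t).card = τ := by
  classical
  have hex : ∃ t, τ ≤ (A.filter fun j : Fin n => (j : ℕ) < t).card := ⟨R, hR⟩
  have h1 := Nat.find_spec hex
  have h2 := fun t => Nat.find_min hex (m := t)
  generalize Nat.find hex = t at h1 h2
  rcases t with _ | t
  · simp at h1; omega
  have h3 := h2 t t.lt_succ_self
  by_cases ht : ∃ x ∈ A, (x : ℕ) = t
  · obtain ⟨x, hx, rfl⟩ := ht
    have e1 : (A.filter fun j : Fin n => (j : ℕ) < (x : ℕ) + 1) = A.filter fun j : Fin n => j ≤ x := by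
      ext j; simp
    have e2 : (A.filter fun j : Fin n => j ≤ x) ⊆ insert x (A.filter fun j : Fin n => (j : ℕ) < x) := by
      intro j
      simp only [Finset.mem_filter, Finset.mem_insert]
      rintro ⟨hj, hle⟩
      rcases hle.eq_or_lt with h | h
      · exact Or.inl h
      · exact Or.inr ⟨hj, h⟩
    have h4 := (Finset.card_le_card e2).trans (Finset.card_insert_le _ _)
    rw [e1] at h1
    exact ⟨x, hx, by omega⟩
  · push Not at ht
    have e1 : (A.filter fun j : Fin n => (j : ℕ) < t + 1) = A.filter fun j : Fin n => (j : ℕ) < t := by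
      apply Finset.filter_congr
      intro j hj
      have := ht j hj
      omega
    rw [e1] at h1
    exact absurd h1 h3

theorem card_observed_le (m : ℕ) (r : Equiv.Perm (Fin n)) (t : Fin n) :
    (Finset.univ.filter fun p : Fin n => (p : ℕ) < m ∧ r p ≤ t).card =
      ((Finset.univ.filter fun j : Fin n => (r.symm j : ℕ) < m).filter fun j => j ≤ t).card := by
  rw [← Finset.card_map r.toEmbedding]
  congr 1
  ext j
  simp only [Finset.mem_map, Finset.mem_filter, Finset.mem_univ, true_and, Equiv.coe_toEmbedding]
  constructor
  · rintro ⟨p, ⟨h1, h2⟩, rfl⟩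
    simpa using ⟨h1, h2⟩
  · rintro ⟨h1, h2⟩
    exact ⟨r.symm j, by simpa using ⟨h1, h2⟩, by simp⟩

/-- A sufficient condition for the item of rank `i` to be selected: it is not observed, fewer than
`τ` better items are observed, at least `τ` of the `R` best items are observed, and fewer than `k`
of the `R` best items arrive before it. -/
theorem mem_waitAndPick {m τ k R : ℕ} (r : Equiv.Perm (Fin n)) {i : Fin n} (hτ : 1 ≤ τ)
    (ha : m ≤ (r.symm i : ℕ))
    (hb : (Finset.univ.filter fun j : Fin n => j < i ∧ (r.symm j : ℕ) < m).card < τ)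
    (hc : τ ≤ (Finset.univ.filter fun j : Fin n => (j : ℕ) < R ∧ (r.symm j : ℕ) < m).card)
    (hd : (Finset.univ.filter fun j : Fin n => (j : ℕ) < R ∧ r.symm j < r.symm i).card < k) :
    r.symm i ∈ waitAndPick m τ k r := by
  set A := Finset.univ.filter fun j : Fin n => (r.symm j : ℕ) < m with hA
  have hiA : i ∉ A := by simpa [hA] using ha
  have hc' : τ ≤ (A.filter fun j : Fin n => (j : ℕ) < R).card := by
    rw [hA, Finset.filter_filter]
    simpa only [and_comm] using hc
  obtain ⟨t, htA, ht⟩ := exists_card_observed_eq A hτ hc'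
  have hstat : IsStatistic m τ r (r.symm t) := by
    refine ⟨by simpa [hA] using htA, ?_⟩
    rw [Equiv.apply_symm_apply, card_observed_le]
    exact ht
  have hit : i < t := by
    by_contra! hle
    refine absurd ht (ne_of_lt (lt_of_le_of_lt (Finset.card_le_card ?_) hb))
    intro j
    simp only [Finset.mem_filter, Finset.mem_univ, true_and]
    rintro ⟨hjA, hjt⟩
    refine ⟨lt_of_le_of_ne (hjt.trans hle) ?_, by simpa [hA] using hjA⟩
    rintro rfl
    exact hiA hjA
  have hbeats : ∀ p, BeatsStatistic m τ r p → (r p : ℕ) < R := by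
    rintro p ⟨-, p', ⟨hp'm, hp'⟩, hlt⟩
    rw [card_observed_le] at hp'
    by_contra! hle
    have hp'A : r p' ∈ A := by simpa [hA] using hp'm
    have hR : R < (r p' : ℕ) := lt_of_le_of_lt hle hlt
    have hss : insert (r p') (A.filter fun j : Fin n => (j : ℕ) < R) ⊆ A.filter fun j : Fin n => j ≤ r p' := by
      intro j
      simp only [Finset.mem_insert, Finset.mem_filter]
      rintro (rfl | ⟨h1, h2⟩)
      · exact ⟨hp'A, le_rfl⟩
      · exact ⟨h1, (h2.trans hR).le⟩
    have hcard := Finset.card_le_card hss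
    rw [Finset.card_insert_of_notMem (by simp [hR.le]), hp'] at hcard
    omega
  simp only [waitAndPick, Finset.mem_filter, Finset.mem_univ, true_and]
  refine ⟨⟨ha, r.symm t, hstat, by simpa using hit⟩, lt_of_le_of_lt ?_ hd⟩
  rw [← Finset.card_map r.toEmbedding]
  refine Finset.card_le_card fun j => ?_
  simp only [Finset.mem_map, Finset.mem_filter, Finset.mem_univ, true_and, Equiv.coe_toEmbedding]
  rintro ⟨p, ⟨h1, h2⟩, rfl⟩
  exact ⟨hbeats p h2, by simpa using h1⟩

/-- The selected value is at least that of the selected items among the `k` best ones. -/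
theorem le_waitAndPickValue (m τ k : ℕ) {v : Fin n → ℝ} (hv : ∀ i, 0 ≤ v i)
    (a σ : Equiv.Perm (Fin n)) (I : Finset (Fin n)) :
    ∑ i ∈ I, v i * (if σ.symm (a.symm i) ∈ waitAndPick m τ k (fun p => a (σ p)) then 1 else 0) ≤
      waitAndPickValue m τ k v a σ := by
  classical
  have h : waitAndPickValue m τ k v a σ = ∑ i, v i *
      (if σ.symm (a.symm i) ∈ waitAndPick m τ k (fun p => a (σ p)) then 1 else 0) := by
    rw [waitAndPickValue, ← Equiv.sum_comp (σ.trans a)]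
    simp
  rw [h]
  refine Finset.sum_le_sum_of_subset_of_nonneg (Finset.subset_univ I) fun i _ _ => ?_
  split_ifs <;> simp [hv i]

theorem waitAndPickValue_nonneg (m τ k : ℕ) {v : Fin n → ℝ} (hv : ∀ i, 0 ≤ v i)
    (a σ : Equiv.Perm (Fin n)) : 0 ≤ waitAndPickValue m τ k v a σ :=
  Finset.sum_nonneg fun _ _ => hv _

variable {q s : ℕ}

theorem seedKey_lt_of_label_lt {x y : ℕ} (hx : x < n) (h : seedLabel q s x < seedLabel q s y) :
    seedKey n q s x < seedKey n q s y := by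
  have := Nat.mul_le_mul_right n (Nat.succ_le_of_lt h)
  rw [Nat.succ_mul] at this
  unfold seedKey
  omega

theorem label_le_of_sortPosition_lt {x y : ℕ} (hy : y < n)
    (h : sortPosition n (seedKey n q s) x < sortPosition n (seedKey n q s) y) :
    seedLabel q s x ≤ seedLabel q s y := by
  by_contra! hlt
  exact absurd (sortPosition_lt_sortPosition hy (seedKey_lt_of_label_lt hy hlt)) h.not_gt

theorem sortPosition_lt_of_label_lt {x m c : ℕ} (hx : x < n)
    (hc : ((Finset.range n).filter (seedLabel q s · < c)).card ≤ m) (h : seedLabel q s x < c) :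
    sortPosition n (seedKey n q s) x < m := by
  refine lt_of_lt_of_le (Finset.card_lt_card ?_) hc
  rw [Finset.ssubset_iff_of_subset]
  · exact ⟨x, by simp [hx, h], by simp⟩
  · intro y
    simp only [Finset.mem_filter, Finset.mem_range]
    rintro ⟨hy, hlt⟩
    refine ⟨hy, lt_of_le_of_lt ?_ h⟩
    by_contra! h'
    exact absurd (seedKey_lt_of_label_lt hx h') hlt.not_gt

theorem label_lt_of_sortPosition_lt {x m c : ℕ}
    (hc : m ≤ ((Finset.range n).filter (seedLabel q s · < c)).card)
    (h : sortPosition n (seedKey n q s) x < m) : seedLabel q s x < c := by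
  by_contra! hle
  refine absurd (h.trans_le hc) (not_lt.2 (Finset.card_le_card ?_))
  intro y
  simp only [Finset.mem_filter, Finset.mem_range]
  rintro ⟨hy, hlt⟩
  exact ⟨hy, seedKey_lt_of_label_lt hy (hlt.trans_le hle)⟩

/-- A sufficient condition, in terms of the labels, for the item of rank `i` to be selected.
Here `c₁` and `c₂` are lower and upper bounds for the labels at the end of the observation
period. -/
theorem mem_waitAndPick_seedPerm {m τ k R c₁ c₂ : ℕ} (a : Equiv.Perm (Fin n)) {i : Fin n}
    (hτ : 1 ≤ τ)
    (h₁ : ((Finset.range n).filter (seedLabel q s · < c₁)).card ≤ m)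
    (h₂ : m ≤ ((Finset.range n).filter (seedLabel q s · < c₂)).card)
    (ha : c₂ ≤ seedLabel q s (a.symm i))
    (hb : (Finset.univ.filter fun j : Fin n => j < i ∧ seedLabel q s (a.symm j) < c₂).card < τ)
    (hc : τ ≤ (Finset.univ.filter fun j : Fin n =>
      ((j : ℕ) < R ∧ j ≠ i) ∧ seedLabel q s (a.symm j) < c₁).card)
    (hd : (Finset.univ.filter fun j : Fin n => ((j : ℕ) < R ∧ j ≠ i) ∧
      seedLabel q s (a.symm j) < seedLabel q s (a.symm i) + 1).card < k) :
    (seedPerm n q s).symm (a.symm i) ∈ waitAndPick m τ k (fun p => a (seedPerm n q s p)) := by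
  have hpos : ∀ x : Fin n, (((seedPerm n q s).symm x : Fin n) : ℕ) =
      sortPosition n (seedKey n q s) x := sortPerm_symm_val (seedKey_inj n q s)
  refine mem_waitAndPick (R := R) ((seedPerm n q s).trans a) hτ ?_ ?_ ?_ ?_
  · simp only [Equiv.symm_trans_apply, hpos]
    by_contra! h
    exact absurd (label_lt_of_sortPosition_lt h₂ h) (not_lt.2 ha)
  · refine lt_of_le_of_lt (Finset.card_le_card fun j => ?_) hb
    simp only [Equiv.symm_trans_apply, hpos, Finset.mem_filter, Finset.mem_univ, true_and]
    exact fun h => ⟨h.1, label_lt_of_sortPosition_lt h₂ h.2⟩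
  · refine hc.trans (Finset.card_le_card fun j => ?_)
    simp only [Equiv.symm_trans_apply, hpos, Finset.mem_filter, Finset.mem_univ, true_and]
    exact fun h => ⟨h.1.1, sortPosition_lt_of_label_lt (Fin.is_lt _) h₁ h.2⟩
  · refine lt_of_le_of_lt (Finset.card_le_card fun j => ?_) hd
    simp only [Equiv.symm_trans_apply, Fin.lt_def, hpos, Finset.mem_filter, Finset.mem_univ,
      true_and]
    rintro ⟨h1, h2⟩
    refine ⟨⟨h1, ?_⟩, Nat.lt_succ_of_le (label_le_of_sortPosition_lt (Fin.is_lt _) h2)⟩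
    rintro rfl
    exact lt_irrefl _ h2

end Selection

/-! ### Uniform distributions on lists -/

section Uniform

variable {n : ℕ}

theorem expectation_uniformOn (L : List (Equiv.Perm (Fin n))) (f : Equiv.Perm (Fin n) → ℝ) :
    expectation (uniformOn L) f = (L.map f).sum / L.length := by
  classical
  rw [Finset.sum_list_map_count, expectation, Finset.sum_div]
  refine (Finset.sum_subset (Finset.subset_univ L.toFinset) fun π _ hπ => ?_).symm.trans ?_
  · have h : L.count π = 0 := List.count_eq_zero.2 (by simpa using hπ)
    simp [uniformOn, h]
  · refine Finset.sum_congr rfl fun π _ => ?_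
    simp only [uniformOn, nsmul_eq_mul]
    ring

/-- The entropy of the uniform distribution on a multi-set is at most the logarithm of its size,
since the probabilities that occur are at least the inverse of the size. -/
theorem shannonEntropy_uniformOn_le {L : List (Equiv.Perm (Fin n))} (hL : L ≠ []) :
    shannonEntropy (uniformOn L) ≤ Real.logb 2 L.length := by
  classical
  have hlen : (0 : ℝ) < L.length := by exact_mod_cast List.length_pos_iff.2 hL
  have hsum : ∑ π, uniformOn L π = 1 := by
    have := expectation_uniformOn L (fun _ => 1)
    simp only [expectation, mul_one, List.map_const', List.sum_replicate, nsmul_eq_mul] at this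
    rw [this, div_self hlen.ne']
  rw [shannonEntropy, neg_le, ← one_mul (-Real.logb 2 _), ← hsum, Finset.sum_mul]
  refine Finset.sum_le_sum fun π _ => ?_
  rcases Nat.eq_zero_or_pos (L.count π) with h | h
  · simp [uniformOn, h]
  · have h1 : (1 : ℝ) ≤ L.count π := by exact_mod_cast h
    rw [← Real.logb_inv]
    refine mul_le_mul_of_nonneg_left ?_ (by unfold uniformOn; positivity)
    refine Real.logb_le_logb_of_le (by norm_num) (by positivity) ?_
    rw [uniformOn, inv_eq_one_div]
    gcongr

end Uniform

/-! ### Counts of labels and numerical parameters -/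

section Counts

variable {q : ℕ} [Fact q.Prime]

/-- If an event forces a deviation of a count by `t`, then Chebyshev's inequality bounds the number
of polynomials in the event that have the value `y₀` at `z₀`. -/
theorem card_le_of_deviation (hq : 3 ≤ q) {z₀ : ZMod q} (y₀ : ZMod q) {J : Finset (ZMod q)}
    (hJ : z₀ ∉ J) {c : ℕ} (hc : c ≤ q) {t V : ℝ} (ht : 0 < t)
    {E : ZMod q × ZMod q × ZMod q → Prop} [DecidablePred E]
    (hE : ∀ g, E g → t ≤ |(lowCount J c g : ℝ) - J.card * (c / q)|)
    (hV : (J.card : ℝ) * (q * c) ≤ V * t ^ 2) :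
    ((Finset.univ.filter fun g : ZMod q × ZMod q × ZMod q =>
      quadEval g z₀ = y₀ ∧ E g).card : ℝ) ≤ V := by
  have h1 := lowCount_chebyshev hq y₀ hJ hc ht.le
  refine le_of_mul_le_mul_right (le_trans ?_ (h1.trans hV)) (by positivity : 0 < t ^ 2)
  refine mul_le_mul_of_nonneg_right ?_ (by positivity)
  refine Nat.cast_le.2 (Finset.card_le_card fun g => ?_)
  simp only [Finset.mem_filter, Finset.mem_univ, true_and]
  exact fun hg => ⟨hg.1, hE g hg.2⟩

theorem card_quadEval_eq (hq : 3 ≤ q) (z₀ y₀ : ZMod q) :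
    ((Finset.univ.filter fun g : ZMod q × ZMod q × ZMod q => quadEval g z₀ = y₀).card : ℝ) =
      (q : ℝ) ^ 2 := by
  have hz : z₀ ≠ z₀ + 1 := by
    have : Nontrivial (ZMod q) := ZMod.nontrivial_iff.2 (by omega)
    simp
  have := sum_quadEval_mul_two hq hz (fun y => if y = y₀ then 1 else 0) (fun _ => 1)
  simp only [mul_one, Finset.sum_boole, Finset.sum_const, Finset.card_univ, ZMod.card,
    nsmul_eq_mul] at this
  rw [this, Finset.filter_eq' _ y₀]
  simp [pow_two]

/-- The number of items below a label threshold, in terms of the values of the polynomial. -/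
theorem card_label_lt (n u c : ℕ) (g : ZMod q × ZMod q × ZMod q) :
    lowCount Finset.univ c g * (n / q) ≤
      ((Finset.range n).filter fun x => (quadEval g (rsHash q u x : ZMod q)).val < c).card ∧
    ((Finset.range n).filter fun x => (quadEval g (rsHash q u x : ZMod q)).val < c).card ≤
      lowCount Finset.univ c g * (n / q + 1) := by
  have h : ((Finset.range n).filter fun x => (quadEval g (rsHash q u x : ZMod q)).val < c).card =
      ∑ z ∈ Finset.univ.filter (fun z => (quadEval g z).val < c),
        ((Finset.range n).filter fun x => (rsHash q u x : ZMod q) = z).card := by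
    rw [Finset.card_eq_sum_card_fiberwise (f := fun x => (rsHash q u x : ZMod q))
      (t := Finset.univ.filter (fun z => (quadEval g z).val < c))]
    · refine Finset.sum_congr rfl fun z hz => ?_
      rw [Finset.filter_filter]
      congr 1
      refine Finset.filter_congr fun x _ => ⟨fun h => h.2, fun h => ⟨?_, h⟩⟩
      rw [h]
      exact (Finset.mem_filter.1 hz).2
    · intro x hx
      simpa using (Finset.mem_filter.1 hx).2
  rw [h, lowCount]
  exact ⟨by simpa using Finset.card_nsmul_le_sum _ _ _ fun z _ => le_card_rsHash_eq n u z,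
    by simpa using Finset.sum_le_card_nsmul _ _ _ fun z _ => card_rsHash_eq_le n u z⟩

theorem lowCount_univ_le (z₀ : ZMod q) (c : ℕ) (g : ZMod q × ZMod q × ZMod q) :
    lowCount (Finset.univ.erase z₀) c g ≤ lowCount Finset.univ c g ∧
      lowCount Finset.univ c g ≤ lowCount (Finset.univ.erase z₀) c g + 1 := by
  refine ⟨Finset.card_le_card (Finset.filter_subset_filter _ (Finset.subset_univ _)), ?_⟩
  rw [lowCount, lowCount, Finset.filter_erase]
  exact Nat.sub_le_iff_le_add.1 Finset.pred_card_le_card_erase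

/-- A count of ranks by their labels is a count of points, if the hash is injective on them. -/
theorem card_rank_eq_lowCount {n : ℕ} (P : Fin n → Prop) [DecidablePred P] (z : Fin n → ZMod q)
    (hz : ∀ i j, P i → P j → z i = z j → i = j) (c : ℕ) (g : ZMod q × ZMod q × ZMod q) :
    (Finset.univ.filter fun j : Fin n => P j ∧ (quadEval g (z j)).val < c).card =
      lowCount ((Finset.univ.filter P).image z) c g := by
  rw [lowCount, Finset.filter_image, Finset.card_image_of_injOn, Finset.filter_filter]
  intro i hi j hj h
  simp only [Finset.coe_filter, Finset.mem_filter, Finset.mem_univ, true_and,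
    Set.mem_ofPred_eq] at hi hj
  exact hz i j hi.1 hj.1 h

/-- The sum of `min 1 (A ^ 2 / d ^ 2)` over `d ≥ 1` is `O(A)`, by comparison with the telescoping
differences of `4 A ^ 2 / (A + d)`. -/
theorem sum_min_sq_div_le {A : ℝ} (hA : 0 < A) (N : ℕ) :
    ∑ d ∈ Finset.range N, min 1 (A ^ 2 / ((d : ℝ) + 1) ^ 2) ≤ 4 * A := by
  have key : ∀ N : ℕ, ∑ d ∈ Finset.range N, min 1 (A ^ 2 / ((d : ℝ) + 1) ^ 2) ≤
      4 * A - 4 * A ^ 2 / (A + N) := by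
    intro N
    induction N with
    | zero => simp; field_simp; norm_num
    | succ N ih =>
      rw [Finset.sum_range_succ]
      have hN : (0 : ℝ) ≤ N := N.cast_nonneg
      have hstep : 4 * A ^ 2 / (A + N) - 4 * A ^ 2 / (A + (N + 1)) =
          4 * A ^ 2 / ((A + N) * (A + (N + 1))) := by
        field_simp; ring
      have : min 1 (A ^ 2 / ((N : ℝ) + 1) ^ 2) ≤ 4 * A ^ 2 / ((A + N) * (A + (N + 1))) := by
        rcases le_total A (N + 1) with h | h
        · refine (min_le_right _ _).trans ?_
          rw [div_le_div_iff₀ (by positivity) (by positivity)]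
          have : (A + N) * (A + (N + 1)) ≤ 4 * ((N : ℝ) + 1) ^ 2 := by nlinarith
          nlinarith [mul_le_mul_of_nonneg_left this (sq_nonneg A)]
        · refine (min_le_left _ _).trans ?_
          rw [le_div_iff₀ (by positivity)]
          nlinarith
      push_cast
      linarith
  have h := key N
  have : 0 ≤ 4 * A ^ 2 / (A + N) := by positivity
  linarith

/-- The numerical relations between the parameters: `κ` is the cube root of `k`, the observation
period consists of `m ≈ n / κ` items, the statistic is `τ ≈ κ ^ 2`, and `L` bounds the number of
base-`q` digits of the items. -/
structure Params (n k q L m τ : ℕ) (κ : ℝ) : Prop where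
  ten_le : 10 ≤ κ
  cube : κ ^ 3 = k
  pos_L : 1 ≤ L
  le_q : 16 * k ^ 3 * L ≤ q
  q_sq_le : q ^ 2 ≤ n
  n_le : n ≤ q ^ L
  m_le : (m : ℝ) ≤ n / κ
  lt_m : (n : ℝ) / κ - 1 < m
  τ_le : (τ : ℝ) ≤ κ ^ 2
  lt_τ : κ ^ 2 - 1 < τ

end Counts

/-! ### The events that make an item fail -/

namespace Params

variable {n k q L m τ : ℕ} {κ : ℝ}

/-- A label bound that the observation period almost surely exceeds; on average its end has the
label `q / κ`. -/
noncomputable def lowCut (q : ℕ) (κ : ℝ) : ℕ := ⌊(q : ℝ) * (1 / κ - 2 / κ ^ 3)⌋₊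

/-- A label bound that the observation period almost surely does not exceed. -/
noncomputable def highCut (q : ℕ) (κ : ℝ) : ℕ := ⌈(q : ℝ) * (1 / κ + 2 / κ ^ 3)⌉₊

theorem q_large (h : Params n k q L m τ κ) : 16 * κ ^ 9 ≤ q := by
  have h1 : ((16 * k ^ 3 * L : ℕ) : ℝ) ≤ q := by exact_mod_cast h.le_q
  have h2 : (1 : ℝ) ≤ L := by exact_mod_cast h.pos_L
  have h3 : (k : ℝ) ^ 3 = κ ^ 9 := by rw [← h.cube]; ring
  push_cast at h1
  rw [h3] at h1
  have h10 := h.ten_le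
  have : 0 ≤ 16 * κ ^ 9 := by positivity
  nlinarith

theorem three_le_q (h : Params n k q L m τ κ) : 3 ≤ q := by
  have h1 := h.q_large
  have h2 : (10 : ℝ) ^ 9 ≤ κ ^ 9 := pow_le_pow_left₀ (by norm_num) h.ten_le 9
  have : (3 : ℝ) ≤ q := by linarith
  exact_mod_cast this

theorem lowCut_le (h : Params n k q L m τ κ) : (lowCut q κ : ℝ) ≤ q * (1 / κ - 2 / κ ^ 3) := by
  have h10 := h.ten_le
  refine Nat.floor_le (mul_nonneg (by positivity) ?_)
  rw [sub_nonneg, div_le_div_iff₀ (by positivity) (by positivity)]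
  nlinarith [mul_pos (show 0 < κ by linarith) (show 0 < κ by linarith)]

theorem lt_lowCut : (q : ℝ) * (1 / κ - 2 / κ ^ 3) - 1 < lowCut q κ := by
  have := Nat.lt_floor_add_one ((q : ℝ) * (1 / κ - 2 / κ ^ 3))
  unfold lowCut
  linarith

theorem le_highCut : (q : ℝ) * (1 / κ + 2 / κ ^ 3) ≤ highCut q κ := Nat.le_ceil _

theorem highCut_lt (h : Params n k q L m τ κ) :
    (highCut q κ : ℝ) < q * (1 / κ + 2 / κ ^ 3) + 1 := by
  have h10 := h.ten_le
  exact Nat.ceil_lt_add_one (by positivity)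

theorem lowCut_le_div (h : Params n k q L m τ κ) : (lowCut q κ : ℝ) ≤ q / κ := by
  have h10 := h.ten_le
  have h1 := h.lowCut_le
  have h2 : (q : ℝ) * (1 / κ - 2 / κ ^ 3) = q / κ - 2 * q / κ ^ 3 := by ring
  have : 0 ≤ 2 * (q : ℝ) / κ ^ 3 := by positivity
  linarith

theorem le_lowCut_div (h : Params n k q L m τ κ) : (q : ℝ) * (1 / κ - 3 / κ ^ 3) ≤ lowCut q κ := by
  have h10 := h.ten_le
  have h1 := lt_lowCut (q := q) (κ := κ)
  have h3 : 1 ≤ q / κ ^ 3 := by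
    rw [one_le_div (by positivity)]
    have : κ ^ 3 ≤ κ ^ 9 := pow_le_pow_right₀ (by linarith) (by norm_num)
    have : 0 ≤ κ ^ 9 := by positivity
    linarith [h.q_large]
  have h2 : (q : ℝ) * (1 / κ - 3 / κ ^ 3) = q * (1 / κ - 2 / κ ^ 3) - q / κ ^ 3 := by ring
  linarith

theorem highCut_le_div (h : Params n k q L m τ κ) :
    (highCut q κ : ℝ) ≤ q * (1 / κ + 3 / κ ^ 3) := by
  have h10 := h.ten_le
  have h1 := h.highCut_lt
  have h3 : 1 ≤ q / κ ^ 3 := by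
    rw [one_le_div (by positivity)]
    have : κ ^ 3 ≤ κ ^ 9 := pow_le_pow_right₀ (by linarith) (by norm_num)
    have : 0 ≤ κ ^ 9 := by positivity
    linarith [h.q_large]
  have h2 : (q : ℝ) * (1 / κ + 3 / κ ^ 3) = q * (1 / κ + 2 / κ ^ 3) + q / κ ^ 3 := by ring
  linarith

theorem lowCut_le_q (h : Params n k q L m τ κ) : lowCut q κ ≤ q := by
  have h10 := h.ten_le
  have h1 := h.lowCut_le_div
  have h2 : (q : ℝ) / κ ≤ q := div_le_self (by positivity) (by linarith)
  exact_mod_cast h1.trans h2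

theorem cut_sum_le (h : Params n k q L m τ κ) : 1 / κ + 3 / κ ^ 3 ≤ 2 / κ := by
  have h10 := h.ten_le
  rw [div_add_div _ _ (by positivity) (by positivity), div_le_div_iff₀ (by positivity)
    (by positivity)]
  have h3 : 3 ≤ κ ^ 2 := by nlinarith
  nlinarith [mul_le_mul_of_nonneg_right h3 (sq_nonneg κ)]

theorem highCut_le_q (h : Params n k q L m τ κ) : highCut q κ ≤ q := by
  have h10 := h.ten_le
  have h1 := h.highCut_le_div
  have h2 := h.cut_sum_le
  have h3 : 2 / κ ≤ 1 := by rw [div_le_one (by positivity)]; linarith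
  have h4 : (q : ℝ) * (1 / κ + 3 / κ ^ 3) ≤ q * 1 :=
    mul_le_mul_of_nonneg_left (h2.trans h3) (by positivity)
  rw [mul_one] at h4
  exact_mod_cast h1.trans h4

theorem cut_num_low {κ Q X : ℝ} (h10 : 10 ≤ κ) (hQ : 16 * κ ^ 9 ≤ Q) (hX : Q ≤ X) :
    (Q * (1 / κ - 2 / κ ^ 3) + Q / (2 * κ ^ 3) + 1) * (X + 1) ≤ Q * X / κ - 1 := by
  have h3 : 1000 ≤ κ ^ 3 := by
    have : (10 : ℝ) ^ 3 ≤ κ ^ 3 := pow_le_pow_left₀ (by norm_num) h10 3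
    linarith
  have h93 : κ ^ 3 ≤ κ ^ 9 := pow_le_pow_right₀ (by linarith) (by norm_num)
  have h23 : κ ^ 2 ≤ κ ^ 3 := pow_le_pow_right₀ (by linarith) (by norm_num)
  have hQ3 : 16 * κ ^ 3 ≤ Q := by linarith
  have hQ0 : 0 < Q := by linarith
  have hX0 : 0 < X := by linarith
  have e : Q * X / κ - 1 - (Q * (1 / κ - 2 / κ ^ 3) + Q / (2 * κ ^ 3) + 1) * (X + 1) =
      (3 / 2 * (Q * X) + 3 / 2 * Q - Q * κ ^ 2 - κ ^ 3 * X - 2 * κ ^ 3) / κ ^ 3 := by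
    field_simp; ring
  have h1 : κ ^ 3 * X ≤ Q / 16 * X := mul_le_mul_of_nonneg_right (by linarith) hX0.le
  have h2 : Q * κ ^ 2 ≤ Q * (X / 16) := mul_le_mul_of_nonneg_left (by linarith) hQ0.le
  have h4 : 0 < Q * X := by positivity
  have : 0 ≤ (3 / 2 * (Q * X) + 3 / 2 * Q - Q * κ ^ 2 - κ ^ 3 * X - 2 * κ ^ 3) / κ ^ 3 :=
    div_nonneg (by linarith) (by linarith)
  linarith

theorem cut_num_high {κ Q X : ℝ} (h10 : 10 ≤ κ) (hQ : 16 * κ ^ 9 ≤ Q) (hX : Q ≤ X) :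
    Q * X / κ ≤ (Q * (1 / κ + 2 / κ ^ 3) - 1 - Q / (2 * κ ^ 3)) * (X - 1) := by
  have h3 : 1000 ≤ κ ^ 3 := by
    have : (10 : ℝ) ^ 3 ≤ κ ^ 3 := pow_le_pow_left₀ (by norm_num) h10 3
    linarith
  have h93 : κ ^ 3 ≤ κ ^ 9 := pow_le_pow_right₀ (by linarith) (by norm_num)
  have h23 : κ ^ 2 ≤ κ ^ 3 := pow_le_pow_right₀ (by linarith) (by norm_num)
  have hQ3 : 16 * κ ^ 3 ≤ Q := by linarith
  have hQ0 : 0 < Q := by linarith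
  have hX0 : 0 < X := by linarith
  have e : (Q * (1 / κ + 2 / κ ^ 3) - 1 - Q / (2 * κ ^ 3)) * (X - 1) - Q * X / κ =
      (3 / 2 * (Q * X) - 3 / 2 * Q - Q * κ ^ 2 - κ ^ 3 * X + κ ^ 3) / κ ^ 3 := by
    field_simp; ring
  have h1 : κ ^ 3 * X ≤ Q / 16 * X := mul_le_mul_of_nonneg_right (by linarith) hX0.le
  have h2 : Q * κ ^ 2 ≤ Q * (X / 16) := mul_le_mul_of_nonneg_left (by linarith) hQ0.le
  have h4 : Q * 1000 ≤ Q * X := mul_le_mul_of_nonneg_left (by linarith) hQ0.le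
  have : 0 ≤ (3 / 2 * (Q * X) - 3 / 2 * Q - Q * κ ^ 2 - κ ^ 3 * X + κ ^ 3) / κ ^ 3 :=
    div_nonneg (by linarith) (by linarith)
  linarith

theorem n_div_q (h : Params n k q L m τ κ) : (q : ℝ) ≤ n / q ∧ (q : ℝ) * (n / q) = n := by
  have hq : (0 : ℝ) < q := by have := h.three_le_q; positivity
  refine ⟨?_, by field_simp⟩
  rw [le_div_iff₀ hq, ← pow_two]
  exact_mod_cast h.q_sq_le

variable [Fact q.Prime]

theorem card_erase_mul_le (h : Params n k q L m τ κ) (z₀ : ZMod q) {c : ℕ} (hc : c ≤ q) :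
    (((Finset.univ.erase z₀).card : ℕ) : ℝ) * (q * c) ≤
      (q : ℝ) ^ 2 / (4 * κ ^ 3) * (q / (2 * κ ^ 3)) ^ 2 := by
  have h10 := h.ten_le
  have hcard : (((Finset.univ.erase z₀).card : ℕ) : ℝ) ≤ q := by
    have : (Finset.univ.erase z₀).card ≤ q :=
      (Finset.card_le_card (Finset.subset_univ _)).trans_eq (by rw [Finset.card_univ, ZMod.card])
    exact_mod_cast this
  have hc' : (c : ℝ) ≤ q := by exact_mod_cast hc
  have h1 : (((Finset.univ.erase z₀).card : ℕ) : ℝ) * (q * c) ≤ q * (q * q) := by gcongr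
  have h2 : (q : ℝ) ^ 2 / (4 * κ ^ 3) * (q / (2 * κ ^ 3)) ^ 2 =
      (q : ℝ) ^ 3 * (q / (16 * κ ^ 9)) := by
    field_simp; ring
  have h3 : 1 ≤ q / (16 * κ ^ 9) := by
    rw [one_le_div (by positivity)]; exact h.q_large
  rw [h2]
  calc _ ≤ q * ((q : ℝ) * q) := h1
    _ = (q : ℝ) ^ 3 * 1 := by ring
    _ ≤ _ := by gcongr

/-- The observation period is unlikely to end before all labels below `lowCut` are over. -/
theorem card_low_le (h : Params n k q L m τ κ) (u : ℕ) (z₀ y₀ : ZMod q) :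
    ((Finset.univ.filter fun g : ZMod q × ZMod q × ZMod q => quadEval g z₀ = y₀ ∧
      m < ((Finset.range n).filter
        fun x => (quadEval g (rsHash q u x : ZMod q)).val < lowCut q κ).card).card : ℝ) ≤
      (q : ℝ) ^ 2 / (4 * κ ^ 3) := by
  have h10 := h.ten_le
  have hq : (0 : ℝ) < q := by have := h.three_le_q; positivity
  refine card_le_of_deviation h.three_le_q y₀ (Finset.notMem_erase z₀ Finset.univ) h.lowCut_le_q
    (t := q / (2 * κ ^ 3)) (by positivity) ?_ (h.card_erase_mul_le z₀ h.lowCut_le_q)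
  intro g hg
  by_contra! hlt
  have h1 := (abs_lt.1 hlt).2
  have hcard : (((Finset.univ.erase z₀).card : ℕ) : ℝ) = q - 1 := by
    rw [Finset.card_erase_of_mem (Finset.mem_univ _), Finset.card_univ, ZMod.card,
      Nat.cast_sub (by have := h.three_le_q; omega)]
    simp
  rw [hcard] at h1
  have h2 : ((q : ℝ) - 1) * (lowCut q κ / q) ≤ lowCut q κ := by
    have : (0 : ℝ) ≤ (lowCut q κ : ℝ) / q := by positivity
    have e : (q : ℝ) * (lowCut q κ / q) = lowCut q κ := by field_simp
    linarith
  have h3 := h.lowCut_le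
  have h4 : (lowCount Finset.univ (lowCut q κ) g : ℝ) ≤
      lowCount (Finset.univ.erase z₀) (lowCut q κ) g + 1 := by
    exact_mod_cast (lowCount_univ_le z₀ (lowCut q κ) g).2
  have h5 : (m : ℝ) < lowCount Finset.univ (lowCut q κ) g * (n / q + 1) := by
    have e1 : (m : ℝ) < ((lowCount Finset.univ (lowCut q κ) g * (n / q + 1) : ℕ) : ℝ) := by
      exact_mod_cast hg.trans_le (card_label_lt n u (lowCut q κ) g).2
    refine e1.trans_le ?_
    push_cast
    gcongr
    exact Nat.cast_div_le
  obtain ⟨hX, hn⟩ := h.n_div_q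
  have h6 := cut_num_low h10 h.q_large hX
  rw [hn] at h6
  have h7 : (lowCount Finset.univ (lowCut q κ) g : ℝ) * (n / q + 1) ≤
      (q * (1 / κ - 2 / κ ^ 3) + q / (2 * κ ^ 3) + 1) * (n / q + 1) :=
    mul_le_mul_of_nonneg_right (by linarith) (by positivity)
  have h8 := h.lt_m
  linarith

/-- The observation period is unlikely to extend beyond the labels below `highCut`. -/
theorem card_high_le (h : Params n k q L m τ κ) (u : ℕ) (z₀ y₀ : ZMod q) :
    ((Finset.univ.filter fun g : ZMod q × ZMod q × ZMod q => quadEval g z₀ = y₀ ∧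
      ((Finset.range n).filter
        fun x => (quadEval g (rsHash q u x : ZMod q)).val < highCut q κ).card < m).card : ℝ) ≤
      (q : ℝ) ^ 2 / (4 * κ ^ 3) := by
  have h10 := h.ten_le
  have hq : (0 : ℝ) < q := by have := h.three_le_q; positivity
  refine card_le_of_deviation h.three_le_q y₀ (Finset.notMem_erase z₀ Finset.univ) h.highCut_le_q
    (t := q / (2 * κ ^ 3)) (by positivity) ?_ (h.card_erase_mul_le z₀ h.highCut_le_q)
  intro g hg
  by_contra! hlt
  have h1 := (abs_lt.1 hlt).1
  have hcard : (((Finset.univ.erase z₀).card : ℕ) : ℝ) = q - 1 := by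
    rw [Finset.card_erase_of_mem (Finset.mem_univ _), Finset.card_univ, ZMod.card,
      Nat.cast_sub (by have := h.three_le_q; omega)]
    simp
  rw [hcard] at h1
  have h2 : (highCut q κ : ℝ) - 1 ≤ ((q : ℝ) - 1) * (highCut q κ / q) := by
    have e1 : (highCut q κ : ℝ) / q ≤ 1 := by
      rw [div_le_one hq]; exact_mod_cast h.highCut_le_q
    have e : (q : ℝ) * (highCut q κ / q) = highCut q κ := by field_simp
    linarith
  have h3 := le_highCut (q := q) (κ := κ)
  have h4 : (lowCount (Finset.univ.erase z₀) (highCut q κ) g : ℝ) ≤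
      lowCount Finset.univ (highCut q κ) g := by
    exact_mod_cast (lowCount_univ_le z₀ (highCut q κ) g).1
  obtain ⟨hX, hn⟩ := h.n_div_q
  have hX1 : (0 : ℝ) ≤ n / q - 1 := by
    have : (3 : ℝ) ≤ q := by exact_mod_cast h.three_le_q
    linarith
  have h5 : (lowCount Finset.univ (highCut q κ) g : ℝ) * (n / q - 1) < m := by
    have e1 : ((lowCount Finset.univ (highCut q κ) g * (n / q) : ℕ) : ℝ) < m := by
      exact_mod_cast (card_label_lt n u (highCut q κ) g).1.trans_lt hg
    refine lt_of_le_of_lt ?_ e1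
    push_cast
    gcongr
    have := Nat.lt_floor_add_one ((n : ℝ) / q)
    rw [Nat.floor_div_eq_div] at this
    linarith
  have h6 := cut_num_high h10 h.q_large hX
  rw [hn] at h6
  have h7 : (q * (1 / κ + 2 / κ ^ 3) - 1 - q / (2 * κ ^ 3)) * ((n : ℝ) / q - 1) ≤
      (lowCount Finset.univ (highCut q κ) g : ℝ) * (n / q - 1) :=
    mul_le_mul_of_nonneg_right (by linarith) hX1
  have h8 := h.m_le
  linarith

/-- For the item of rank `i < k` it is unlikely that `τ` of the `i` better items are observed. -/
theorem card_stat_low_le (h : Params n k q L m τ κ) {z₀ : ZMod q} (y₀ : ZMod q)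
    {J : Finset (ZMod q)} (hJ : z₀ ∉ J) {i : ℕ} (hJi : J.card = i) (hi : i < k)
    (hd : 8 * κ ^ 4 < ((k : ℝ) - i) ^ 2) :
    ((Finset.univ.filter fun g : ZMod q × ZMod q × ZMod q => quadEval g z₀ = y₀ ∧
      τ ≤ lowCount J (highCut q κ) g).card : ℝ) ≤
      (q : ℝ) ^ 2 * (8 * κ ^ 4 / ((k : ℝ) - i) ^ 2) := by
  have h10 := h.ten_le
  have hκ : 0 < κ := by linarith
  have hq : (0 : ℝ) < q := by have := h.three_le_q; positivity
  have hik : (i : ℝ) < k := by exact_mod_cast hi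
  set d : ℝ := k - i with hdd
  have hd0 : 0 < d := by linarith
  have hd2 : 2 * κ ^ 2 < d := by
    refine lt_of_pow_lt_pow_left₀ 2 hd0.le (lt_of_le_of_lt ?_ hd)
    nlinarith [sq_nonneg (κ ^ 2)]
  have hdκ : 2 * κ < d / κ := by rw [lt_div_iff₀ hκ]; nlinarith
  have hc : (highCut q κ : ℝ) / q ≤ 1 / κ + 3 / κ ^ 3 := by
    rw [div_le_iff₀ hq]
    linarith [h.highCut_le_div, mul_comm (q : ℝ) (1 / κ + 3 / κ ^ 3)]
  have hmean : (i : ℝ) * (highCut q κ / q) ≤ κ ^ 2 - d / κ + 3 := by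
    have e1 : (i : ℝ) * (highCut q κ / q) ≤ i * (1 / κ + 3 / κ ^ 3) := by gcongr
    have e2 : (i : ℝ) * (1 / κ + 3 / κ ^ 3) = κ ^ 2 - d / κ + 3 * (i / κ ^ 3) := by
      have : (i : ℝ) = κ ^ 3 - d := by rw [h.cube, hdd]; ring
      rw [this]; field_simp
    have e3 : (i : ℝ) / κ ^ 3 ≤ 1 := by
      rw [div_le_one (by positivity), h.cube]; exact hik.le
    linarith
  refine card_le_of_deviation h.three_le_q y₀ hJ h.highCut_le_q (t := d / κ / 2) (by positivity)
    ?_ ?_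
  · intro g hg
    have hg' : (τ : ℝ) ≤ lowCount J (highCut q κ) g := by exact_mod_cast hg
    rw [hJi]
    refine le_trans ?_ (le_abs_self _)
    linarith [h.lt_τ]
  · rw [hJi]
    have e1 : (i : ℝ) * (q * highCut q κ) ≤ κ ^ 3 * (q * (q * (2 / κ))) := by
      have : (highCut q κ : ℝ) ≤ q * (2 / κ) :=
        h.highCut_le_div.trans (mul_le_mul_of_nonneg_left h.cut_sum_le hq.le)
      rw [h.cube]
      gcongr
    refine e1.trans (le_of_eq ?_)
    field_simp
    ring

/-- Among `k + w` items, apart from the one with the label `y₀`, it is unlikely that fewer than `τ`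
are observed; here `w = k δ / 2`, where `1 - δ` is the fraction of the labels below `y₀`. -/
theorem card_stat_high_le (h : Params n k q L m τ κ) {z₀ : ZMod q} (y₀ : ZMod q)
    {J : Finset (ZMod q)} (hJ : z₀ ∉ J) {δ : ℝ} (hδ : 8 / κ < δ) (hδ1 : δ ≤ 1)
    (hJc : J.card + 1 = k + ⌊(k : ℝ) * δ / 2⌋₊) :
    ((Finset.univ.filter fun g : ZMod q × ZMod q × ZMod q => quadEval g z₀ = y₀ ∧
      lowCount J (lowCut q κ) g < τ).card : ℝ) ≤ (q : ℝ) ^ 2 * (24 / (κ ^ 2 * δ ^ 2)) := by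
  have h10 := h.ten_le
  have hκ : 0 < κ := by linarith
  have hq : (0 : ℝ) < q := by have := h.three_le_q; positivity
  have hδ0 : 0 < δ := lt_trans (by positivity) hδ
  rw [← h.cube] at hJc
  have hw : 4 * κ < κ ^ 2 * δ / 2 := by
    rw [div_lt_iff₀ hκ] at hδ
    nlinarith
  have hJ1 : (J.card : ℝ) + 1 = κ ^ 3 + ⌊κ ^ 3 * δ / 2⌋₊ := by
    rw [h.cube, ← Nat.cast_add_one, hJc, h.cube]; push_cast; rfl
  have hfl := Nat.floor_le (show 0 ≤ κ ^ 3 * δ / 2 by positivity)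
  have hfl' := Nat.lt_floor_add_one (κ ^ 3 * δ / 2)
  have hJlow : κ ^ 3 + κ ^ 3 * δ / 2 - 2 ≤ J.card := by linarith
  have hJup : (J.card : ℝ) ≤ 3 / 2 * κ ^ 3 := by
    have : κ ^ 3 * δ ≤ κ ^ 3 * 1 := by gcongr
    linarith
  have h3 : 0 ≤ 1 / κ - 3 / κ ^ 3 := by
    rw [sub_nonneg, div_le_div_iff₀ (by positivity) (by positivity)]
    nlinarith [mul_pos hκ hκ]
  have hc : 1 / κ - 3 / κ ^ 3 ≤ (lowCut q κ : ℝ) / q := by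
    rw [le_div_iff₀ hq]
    linarith [h.le_lowCut_div, mul_comm (q : ℝ) (1 / κ - 3 / κ ^ 3)]
  have hmean : κ ^ 2 + κ ^ 2 * δ / 2 - 7 ≤ (J.card : ℝ) * (lowCut q κ / q) := by
    have e1 : (κ ^ 3 + κ ^ 3 * δ / 2 - 2) * (1 / κ - 3 / κ ^ 3) ≤
        (J.card : ℝ) * (lowCut q κ / q) :=
      mul_le_mul hJlow hc h3 (by positivity)
    have e2 : (κ ^ 3 + κ ^ 3 * δ / 2 - 2) * (1 / κ - 3 / κ ^ 3) =
        κ ^ 2 + κ ^ 2 * δ / 2 - 3 - 3 * δ / 2 - 2 / κ + 6 / κ ^ 3 := by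
      field_simp; ring
    have e3 : 2 / κ ≤ 1 := by rw [div_le_one hκ]; linarith
    have e4 : 0 ≤ 6 / κ ^ 3 := by positivity
    linarith
  refine card_le_of_deviation h.three_le_q y₀ hJ h.lowCut_le_q (t := κ ^ 2 * δ / 4)
    (by positivity) ?_ ?_
  · intro g hg
    have hg' : (lowCount J (lowCut q κ) g : ℝ) < τ := by exact_mod_cast hg
    refine le_trans ?_ (neg_le_abs _)
    linarith [h.τ_le]
  · have e1 : (J.card : ℝ) * (q * lowCut q κ) ≤ 3 / 2 * κ ^ 3 * (q * (q / κ)) := by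
      have := h.lowCut_le_div
      gcongr
    refine e1.trans (le_of_eq ?_)
    field_simp
    ring

/-- Among `k + w` items, apart from the one with the label `y₀`, it is unlikely that `k` have a label
of at most `y₀`; here `w = k δ / 2`, where `1 - δ` is the fraction of the labels below `y₀`. -/
theorem card_early_le (h : Params n k q L m τ κ) {z₀ : ZMod q} (y₀ : ZMod q)
    {J : Finset (ZMod q)} (hJ : z₀ ∉ J) {δ : ℝ} (hδ : 8 / κ < δ)
    (hδy : δ = (q - y₀.val : ℝ) / q) (hJc : J.card + 1 = k + ⌊(k : ℝ) * δ / 2⌋₊) :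
    ((Finset.univ.filter fun g : ZMod q × ZMod q × ZMod q => quadEval g z₀ = y₀ ∧
      k ≤ lowCount J (y₀.val + 1) g).card : ℝ) ≤ (q : ℝ) ^ 2 * (24 / (κ ^ 2 * δ ^ 2)) := by
  have h10 := h.ten_le
  have hκ : 0 < κ := by linarith
  have hq : (0 : ℝ) < q := by have := h.three_le_q; positivity
  have hδ0 : 0 < δ := lt_trans (by positivity) hδ
  have hy : y₀.val + 1 ≤ q := ZMod.val_lt y₀
  have hy' : ((y₀.val + 1 : ℕ) : ℝ) / q = 1 - δ + 1 / q := by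
    rw [hδy]; push_cast; field_simp; ring
  have hδ1 : δ ≤ 1 := by
    rw [hδy, div_le_one hq]
    linarith [(Nat.cast_nonneg y₀.val : (0 : ℝ) ≤ y₀.val)]
  rw [← h.cube] at hJc
  have hκ2 : 1 ≤ κ ^ 2 := one_le_pow₀ (by linarith)
  have hw : 8 < κ ^ 3 * δ := by
    rw [div_lt_iff₀ hκ] at hδ
    nlinarith
  have hJ1 : (J.card : ℝ) + 1 = κ ^ 3 + ⌊κ ^ 3 * δ / 2⌋₊ := by
    rw [h.cube, ← Nat.cast_add_one, hJc, h.cube]; push_cast; rfl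
  have hfl := Nat.floor_le (show 0 ≤ κ ^ 3 * δ / 2 by positivity)
  have hJup : (J.card : ℝ) ≤ κ ^ 3 + κ ^ 3 * δ / 2 := by linarith
  have hJup' : (J.card : ℝ) ≤ 3 / 2 * κ ^ 3 := by
    have : κ ^ 3 * δ ≤ κ ^ 3 * 1 := by gcongr
    linarith
  have hmean : (J.card : ℝ) * (((y₀.val + 1 : ℕ) : ℝ) / q) ≤ κ ^ 3 - κ ^ 3 * δ / 2 + 1 := by
    rw [hy']
    have hq1 : 3 / 2 * κ ^ 3 * (1 / q) ≤ 1 := by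
      rw [mul_one_div, div_le_one hq]
      have : κ ^ 3 ≤ κ ^ 9 := pow_le_pow_right₀ (by linarith) (by norm_num)
      have : 0 ≤ κ ^ 9 := by positivity
      linarith [h.q_large]
    have e1 : (J.card : ℝ) * (1 - δ) ≤ (κ ^ 3 + κ ^ 3 * δ / 2) * (1 - δ) :=
      mul_le_mul_of_nonneg_right hJup (by linarith)
    have e2 : (J.card : ℝ) * (1 / q) ≤ 3 / 2 * κ ^ 3 * (1 / q) := by gcongr
    have e3 : (κ ^ 3 + κ ^ 3 * δ / 2) * (1 - δ) =
      κ ^ 3 - κ ^ 3 * δ / 2 - κ ^ 3 * δ ^ 2 / 2 := by ring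
    have e4 : 0 ≤ κ ^ 3 * δ ^ 2 / 2 := by positivity
    rw [mul_add]
    linarith
  refine card_le_of_deviation h.three_le_q y₀ hJ hy (t := κ ^ 3 * δ / 4) (by positivity) ?_ ?_
  · intro g hg
    have hg' : (k : ℝ) ≤ lowCount J (y₀.val + 1) g := by exact_mod_cast hg
    rw [← h.cube] at hg'
    refine le_trans ?_ (le_abs_self _)
    linarith
  · have hyq : ((y₀.val + 1 : ℕ) : ℝ) ≤ q := by exact_mod_cast hy
    have e1 : (J.card : ℝ) * (q * ((y₀.val + 1 : ℕ) : ℝ)) ≤ 3 / 2 * κ ^ 3 * (q * q) := by gcongr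
    have e2 : (q : ℝ) ^ 2 * (24 / (κ ^ 2 * δ ^ 2)) * (κ ^ 3 * δ / 4) ^ 2 =
        3 / 2 * κ ^ 3 * (q * q) * κ := by
      field_simp; ring
    rw [e2]
    have : 0 ≤ 3 / 2 * κ ^ 3 * ((q : ℝ) * q) := by positivity
    nlinarith

end Params

/-! ### The loss probability of an item -/

namespace Params

variable {n k q L m τ : ℕ} {κ : ℝ}

theorem two_mul_k_le (h : Params n k q L m τ κ) : 2 * k ≤ n := by
  have h1 : k ≤ k ^ 3 := Nat.le_self_pow (by norm_num) k
  have h2 : k ^ 3 * 1 ≤ k ^ 3 * L := Nat.mul_le_mul_left _ h.pos_L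
  have h3 := h.le_q
  have h4 : q ≤ q ^ 2 := Nat.le_self_pow (by norm_num) q
  have h5 := h.q_sq_le
  rw [mul_assoc] at h3
  omega

/-- The number of the best items to be considered in deciding the fate of an item with label `y`:
the fewer labels there are above `y`, the closer it is to `k`. -/
noncomputable def relevantCount (k q y : ℕ) : ℕ := k + ⌊(k : ℝ) * ((q - y : ℝ) / q) / 2⌋₊

theorem relevantCount_bounds {y : ℕ} (hq : 0 < q) :
    k ≤ relevantCount k q y ∧ relevantCount k q y ≤ 2 * k := by
  refine ⟨Nat.le_add_right _ _, ?_⟩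
  have hq' : (0 : ℝ) < q := by exact_mod_cast hq
  have h1 : ((q : ℝ) - y) / q ≤ 1 := by
    rw [div_le_one hq']
    linarith [(Nat.cast_nonneg y : (0 : ℝ) ≤ y)]
  have h2 : ⌊(k : ℝ) * ((q - y : ℝ) / q) / 2⌋₊ ≤ k := by
    refine Nat.floor_le_of_le ?_
    have hk : (0 : ℝ) ≤ k := Nat.cast_nonneg k
    nlinarith
  unfold relevantCount
  omega

variable [Fact q.Prime]

/-- The label of the item `x` for the evaluation point `u` and the polynomial `g`. -/
def label (u : ZMod q) (g : ZMod q × ZMod q × ZMod q) (x : ℕ) : ℕ :=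
  (quadEval g (rsHash q u.val x : ZMod q)).val

/-- The conditions on the labels that make the algorithm select the item of rank `i`. -/
def LabelsSelect (m τ k : ℕ) (κ : ℝ) (a : Equiv.Perm (Fin n)) (i : Fin n) (u : ZMod q)
    (g : ZMod q × ZMod q × ZMod q) : Prop :=
  ((Finset.range n).filter (label u g · < lowCut q κ)).card ≤ m ∧
  m ≤ ((Finset.range n).filter (label u g · < highCut q κ)).card ∧
  highCut q κ ≤ label u g (a.symm i) ∧
  (Finset.univ.filter fun j : Fin n => j < i ∧ label u g (a.symm j) < highCut q κ).card < τ ∧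
  τ ≤ (Finset.univ.filter fun j : Fin n =>
    ((j : ℕ) < relevantCount k q (label u g (a.symm i)) ∧ j ≠ i) ∧
      label u g (a.symm j) < lowCut q κ).card ∧
  (Finset.univ.filter fun j : Fin n =>
    ((j : ℕ) < relevantCount k q (label u g (a.symm i)) ∧ j ≠ i) ∧
      label u g (a.symm j) < label u g (a.symm i) + 1).card < k

theorem mem_waitAndPick_of_labelsSelect (h : Params n k q L m τ κ) {a : Equiv.Perm (Fin n)}
    {i : Fin n} {s : ℕ} (hs : LabelsSelect m τ k κ a i (s : ZMod q)
      ((s / q : ℕ), ((s / q / q : ℕ), (s / q / q / q : ℕ)))) :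
    (seedPerm n q s).symm (a.symm i) ∈ waitAndPick m τ k (fun p => a (seedPerm n q s p)) := by
  have hτ : 1 ≤ τ := by
    have h1 := h.lt_τ
    have h10 := h.ten_le
    have : (1 : ℝ) ≤ τ := by nlinarith
    exact_mod_cast this
  have hl : ∀ x, label (s : ZMod q) ((s / q : ℕ), ((s / q / q : ℕ), (s / q / q / q : ℕ))) x =
      seedLabel q s x := fun x => (seedLabel_eq s x).symm
  simp only [LabelsSelect, hl] at hs
  obtain ⟨h1, h2, h3, h4, h5, h6⟩ := hs
  exact mem_waitAndPick_seedPerm a hτ h1 h2 h3 h4 h5 h6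

theorem card_filter_lt_and_ne {R : ℕ} (hR : R ≤ n) {i : Fin n} (hi : (i : ℕ) < R) :
    (Finset.univ.filter fun j : Fin n => (j : ℕ) < R ∧ j ≠ i).card + 1 = R := by
  have h1 : (Finset.univ.filter fun j : Fin n => (j : ℕ) < R ∧ j ≠ i) =
      (Finset.univ.filter fun j : Fin n => (j : ℕ) < R).erase i := by
    ext j
    simp [and_comm]
  rw [h1, Finset.card_erase_add_one (by simpa using hi), Fin.card_filter_val_lt,
    Nat.min_eq_right hR]

/-- The failure probability of the item of rank `i`, conditional on its label. -/
theorem card_not_labelsSelect_le_of_eq (h : Params n k q L m τ κ) (a : Equiv.Perm (Fin n))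
    {i : Fin n} (hi : (i : ℕ) < k) {u : ZMod q}
    (hu : ∀ j j' : Fin n, (j : ℕ) < 2 * k → (j' : ℕ) < 2 * k →
      (rsHash q u.val (a.symm j) : ZMod q) = rsHash q u.val (a.symm j') → j = j') (y₀ : ZMod q)
    [DecidablePred (LabelsSelect m τ k κ a i u)] :
    ((Finset.univ.filter fun g : ZMod q × ZMod q × ZMod q =>
      quadEval g (rsHash q u.val (a.symm i) : ZMod q) = y₀ ∧
        ¬ LabelsSelect m τ k κ a i u g).card : ℝ) ≤
      (q : ℝ) ^ 2 * ((if y₀.val < highCut q κ then 1 else 0) + 1 / (2 * κ ^ 3) +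
        min 1 (8 * κ ^ 4 / ((k : ℝ) - i) ^ 2) +
        min 1 (64 / (κ ^ 2 * ((q - y₀.val : ℝ) / q) ^ 2))) := by
  have h10 := h.ten_le
  have hκ : 0 < κ := by linarith
  have hq : (0 : ℝ) < q := by have := h.three_le_q; positivity
  set z : Fin n → ZMod q := fun j => (rsHash q u.val (a.symm j) : ZMod q) with hz
  set δ : ℝ := (q - y₀.val : ℝ) / q with hδ
  have hylt : (y₀.val : ℝ) < q := by exact_mod_cast ZMod.val_lt y₀
  have hδ0 : 0 < δ := div_pos (by linarith) hq
  have hδ1 : δ ≤ 1 := by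
    rw [hδ, div_le_one hq]
    linarith [(Nat.cast_nonneg y₀.val : (0 : ℝ) ≤ y₀.val)]
  have hik : (0 : ℝ) < k - i := by
    have : ((i : ℕ) : ℝ) < k := by exact_mod_cast hi
    linarith
  have hmin1 : 0 ≤ min 1 (8 * κ ^ 4 / ((k : ℝ) - i) ^ 2) := le_min zero_le_one (by positivity)
  have hmin2 : 0 ≤ min 1 (64 / (κ ^ 2 * δ ^ 2)) := le_min zero_le_one (by positivity)
  have hite : (0 : ℝ) ≤ if y₀.val < highCut q κ then 1 else 0 := by split_ifs <;> norm_num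
  have h3 : 0 ≤ 1 / (2 * κ ^ 3) := by positivity
  have htriv : ∀ b : ℝ, 1 ≤ b → ((Finset.univ.filter fun g : ZMod q × ZMod q × ZMod q =>
      quadEval g (z i) = y₀ ∧ ¬ LabelsSelect m τ k κ a i u g).card : ℝ) ≤ (q : ℝ) ^ 2 * b := by
    intro b hb
    have h1 := card_quadEval_eq h.three_le_q (z i) y₀
    have h2 : ((Finset.univ.filter fun g : ZMod q × ZMod q × ZMod q =>
        quadEval g (z i) = y₀ ∧ ¬ LabelsSelect m τ k κ a i u g).card : ℝ) ≤
        (Finset.univ.filter fun g : ZMod q × ZMod q × ZMod q => quadEval g (z i) = y₀).card := by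
      refine Nat.cast_le.2 (Finset.card_le_card fun g => ?_)
      simp only [Finset.mem_filter, Finset.mem_univ, true_and]
      exact fun hg => hg.1
    rw [h1] at h2
    exact h2.trans (le_mul_of_one_le_right (by positivity) hb)
  by_cases hy : y₀.val < highCut q κ
  · refine htriv _ ?_
    rw [if_pos hy]
    linarith
  by_cases hd : 8 * κ ^ 4 < ((k : ℝ) - i) ^ 2
  swap
  · refine htriv _ ?_
    rw [min_eq_left ((one_le_div (by positivity)).2 (not_lt.1 hd))]
    linarith
  by_cases hδκ : 8 / κ < δ
  swap
  · refine htriv _ ?_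
    have h1 : κ * δ ≤ 8 := by
      rw [not_lt, le_div_iff₀ hκ] at hδκ
      linarith
    have h2 : κ ^ 2 * δ ^ 2 ≤ 64 := by
      rw [← mul_pow]
      have := pow_le_pow_left₀ (by positivity) h1 2
      linarith
    rw [min_eq_left ((one_le_div (by positivity)).2 h2)]
    linarith
  -- The remaining case: five events, each bounded by Chebyshev's inequality.
  set R := relevantCount k q y₀.val with hR
  obtain ⟨hkR, hR2⟩ := relevantCount_bounds (k := k) (Nat.pos_of_ne_zero (NeZero.ne q))
    (y := y₀.val)
  have hiR : (i : ℕ) < R := lt_of_lt_of_le hi hkR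
  set P₁ : Fin n → Prop := fun j => j < i
  set P₂ : Fin n → Prop := fun j => (j : ℕ) < R ∧ j ≠ i
  set J₁ := (Finset.univ.filter P₁).image z with hJ₁
  set J₂ := (Finset.univ.filter P₂).image z with hJ₂
  have hP₁ : ∀ j, P₁ j → (j : ℕ) < 2 * k := fun j (hj : j < i) => by
    have : (j : ℕ) < i := hj
    omega
  have hP₂ : ∀ j, P₂ j → (j : ℕ) < 2 * k := fun j hj => lt_of_lt_of_le hj.1 hR2
  have hz₁ : ∀ j j', P₁ j → P₁ j' → z j = z j' → j = j' := fun j j' hj hj' =>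
    hu j j' (hP₁ j hj) (hP₁ j' hj')
  have hz₂ : ∀ j j', P₂ j → P₂ j' → z j = z j' → j = j' := fun j j' hj hj' =>
    hu j j' (hP₂ j hj) (hP₂ j' hj')
  have hi2 : (i : ℕ) < 2 * k := by omega
  have hJ₁z : z i ∉ J₁ := by
    rw [hJ₁, Finset.mem_image]
    rintro ⟨j, hj, hji⟩
    have hj' : P₁ j := (Finset.mem_filter.1 hj).2
    exact absurd (hu j i (hP₁ j hj') hi2 hji) hj'.ne
  have hJ₂z : z i ∉ J₂ := by
    rw [hJ₂, Finset.mem_image]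
    rintro ⟨j, hj, hji⟩
    have hj' : P₂ j := (Finset.mem_filter.1 hj).2
    exact absurd (hu j i (hP₂ j hj') hi2 hji) hj'.2
  have hJ₁c : J₁.card = i := by
    rw [hJ₁, Finset.card_image_of_injOn fun j hj j' hj' => hz₁ j j' (by simpa using hj)
      (by simpa using hj')]
    rw [show Finset.univ.filter P₁ = Finset.Iio i by ext j; simp [P₁], Fin.card_Iio]
  have hJ₂c : J₂.card + 1 = k + ⌊(k : ℝ) * δ / 2⌋₊ := by
    rw [hJ₂, Finset.card_image_of_injOn fun j hj j' hj' => hz₂ j j' (by simpa using hj)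
      (by simpa using hj')]
    exact card_filter_lt_and_ne (hR2.trans h.two_mul_k_le) hiR
  have b1 := h.card_low_le u.val (z i) y₀
  have b2 := h.card_high_le u.val (z i) y₀
  have b3 := h.card_stat_low_le y₀ hJ₁z hJ₁c hi hd
  have b4 := h.card_stat_high_le y₀ hJ₂z hδκ hδ1 hJ₂c
  have b5 := h.card_early_le y₀ hJ₂z hδκ hδ hJ₂c
  have hle1 : 8 * κ ^ 4 / ((k : ℝ) - i) ^ 2 ≤ 1 := (div_le_one (by positivity)).2 hd.le
  have hle2 : 64 / (κ ^ 2 * δ ^ 2) ≤ 1 := by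
    rw [div_le_one (by positivity), ← mul_pow]
    have h1 : 8 ≤ κ * δ := by
      rw [div_lt_iff₀ hκ] at hδκ
      linarith
    have := pow_le_pow_left₀ (by norm_num) h1 2
    linarith
  rw [min_eq_right hle1, min_eq_right hle2, if_neg hy]
  have hsub : (Finset.univ.filter fun g : ZMod q × ZMod q × ZMod q =>
      quadEval g (z i) = y₀ ∧ ¬ LabelsSelect m τ k κ a i u g) ⊆
      ((((Finset.univ.filter fun g : ZMod q × ZMod q × ZMod q => quadEval g (z i) = y₀ ∧
        m < ((Finset.range n).filter
          fun x => (quadEval g (rsHash q u.val x : ZMod q)).val < lowCut q κ).card) ∪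
      (Finset.univ.filter fun g : ZMod q × ZMod q × ZMod q => quadEval g (z i) = y₀ ∧
        ((Finset.range n).filter
          fun x => (quadEval g (rsHash q u.val x : ZMod q)).val < highCut q κ).card < m)) ∪
      (Finset.univ.filter fun g : ZMod q × ZMod q × ZMod q => quadEval g (z i) = y₀ ∧
        τ ≤ lowCount J₁ (highCut q κ) g)) ∪
      (Finset.univ.filter fun g : ZMod q × ZMod q × ZMod q => quadEval g (z i) = y₀ ∧
        lowCount J₂ (lowCut q κ) g < τ)) ∪
      (Finset.univ.filter fun g : ZMod q × ZMod q × ZMod q => quadEval g (z i) = y₀ ∧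
        k ≤ lowCount J₂ (y₀.val + 1) g) := by
    intro g
    simp only [Finset.mem_union, Finset.mem_filter, Finset.mem_univ, true_and]
    rintro ⟨hgy, hns⟩
    by_contra! hcon
    obtain ⟨⟨⟨⟨c1, c2⟩, c3⟩, c4⟩, c5⟩ := hcon
    refine hns ?_
    have hli : label u g (a.symm i) = y₀.val := congrArg ZMod.val hgy
    unfold LabelsSelect
    rw [hli]
    refine ⟨c1 hgy, c2 hgy, not_lt.1 hy, ?_, ?_, ?_⟩
    · exact (card_rank_eq_lowCount P₁ z hz₁ (highCut q κ) g).trans_lt (c3 hgy)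
    · exact (c4 hgy).trans_eq (card_rank_eq_lowCount P₂ z hz₂ (lowCut q κ) g).symm
    · exact (card_rank_eq_lowCount P₂ z hz₂ (y₀.val + 1) g).trans_lt (c5 hgy)
  have hcard := (Finset.card_le_card hsub).trans ((Finset.card_union_le _ _).trans
    (Nat.add_le_add_right ((Finset.card_union_le _ _).trans (Nat.add_le_add_right
    ((Finset.card_union_le _ _).trans (Nat.add_le_add_right (Finset.card_union_le _ _) _)) _)) _))
  have hcard' := (Nat.cast_le (α := ℝ)).2 hcard
  push_cast at hcard'
  refine hcard'.trans ?_
  have e1 : (q : ℝ) ^ 2 * (64 / (κ ^ 2 * δ ^ 2)) = (q : ℝ) ^ 2 * (24 / (κ ^ 2 * δ ^ 2)) +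
      (q : ℝ) ^ 2 * (24 / (κ ^ 2 * δ ^ 2)) + (q : ℝ) ^ 2 * (16 / (κ ^ 2 * δ ^ 2)) := by ring
  have e2 : 0 ≤ (q : ℝ) ^ 2 * (16 / (κ ^ 2 * δ ^ 2)) := by positivity
  have e3 : (q : ℝ) ^ 2 * (1 / (2 * κ ^ 3)) =
      (q : ℝ) ^ 2 / (4 * κ ^ 3) + (q : ℝ) ^ 2 / (4 * κ ^ 3) := by field_simp; ring
  rw [zero_add, mul_add, mul_add, e1, e3]
  linarith

/-- The sum over the labels of the conditional probability of arriving too late. -/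
theorem sum_late_le (h : Params n k q L m τ κ) :
    ∑ y : ZMod q, min 1 (64 / (κ ^ 2 * ((q - y.val : ℝ) / q) ^ 2)) ≤ 32 * (q / κ) := by
  have h10 := h.ten_le
  have hκ : 0 < κ := by linarith
  have hq : (0 : ℝ) < q := by have := h.three_le_q; positivity
  rw [← sum_range_natCast, ← Finset.sum_range_reflect]
  refine le_trans (Finset.sum_le_sum fun d hd => ?_)
    ((sum_min_sq_div_le (A := 8 * q / κ) (by positivity) q).trans_eq (by ring))
  have hdq : d < q := Finset.mem_range.1 hd
  have hval : (((q - 1 - d : ℕ) : ZMod q)).val = q - 1 - d := ZMod.val_cast_of_lt (by omega)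
  have hcast : ((q - 1 - d : ℕ) : ℝ) = q - (d + 1) := by
    rw [Nat.sub_sub, Nat.cast_sub (by omega)]; push_cast; ring
  rw [hval, hcast]
  refine le_of_eq ?_
  congr 1
  rw [sub_sub_cancel]
  field_simp
  norm_num

/-- The failure probability of the item of rank `i`, for an evaluation point without collisions. -/
theorem card_not_labelsSelect_le (h : Params n k q L m τ κ) (a : Equiv.Perm (Fin n))
    {i : Fin n} (hi : (i : ℕ) < k) {u : ZMod q}
    (hu : ∀ j j' : Fin n, (j : ℕ) < 2 * k → (j' : ℕ) < 2 * k →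
      (rsHash q u.val (a.symm j) : ZMod q) = rsHash q u.val (a.symm j') → j = j')
    [DecidablePred (LabelsSelect m τ k κ a i u)] :
    ((Finset.univ.filter fun g : ZMod q × ZMod q × ZMod q =>
        ¬ LabelsSelect m τ k κ a i u g).card : ℝ) ≤
      (q : ℝ) ^ 3 * (34 / κ + min 1 (8 * κ ^ 4 / ((k : ℝ) - i) ^ 2)) := by
  have h10 := h.ten_le
  have hκ : 0 < κ := by linarith
  have hq : (0 : ℝ) < q := by have := h.three_le_q; positivity
  rw [Finset.card_eq_sum_card_fiberwise (t := Finset.univ)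
    (f := fun g => quadEval g (rsHash q u.val (a.symm i) : ZMod q)) fun _ _ => by simp]
  push_cast
  have h1 := fun y => h.card_not_labelsSelect_le_of_eq a hi hu y
  refine (Finset.sum_le_sum fun y _ => (le_of_eq ?_).trans (h1 y)).trans ?_
  · rw [Finset.filter_filter]
    simp only [and_comm]
  rw [← Finset.mul_sum, Finset.sum_add_distrib, Finset.sum_add_distrib, Finset.sum_add_distrib,
    Finset.sum_boole, card_val_lt h.highCut_le_q]
  simp only [Finset.sum_const, Finset.card_univ, ZMod.card, nsmul_eq_mul]
  have h2 := h.sum_late_le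
  have h3 := h.highCut_le_div
  set b := min 1 (8 * κ ^ 4 / ((k : ℝ) - i) ^ 2)
  have h4 : (q : ℝ) * (1 / κ + 3 / κ ^ 3) + q * (1 / (2 * κ ^ 3)) ≤ 2 * (q / κ) := by
    have e : 2 * ((q : ℝ) / κ) - ((q : ℝ) * (1 / κ + 3 / κ ^ 3) + q * (1 / (2 * κ ^ 3))) =
        q * (κ ^ 2 - 7 / 2) / κ ^ 3 := by field_simp; ring
    have : 0 ≤ (q : ℝ) * (κ ^ 2 - 7 / 2) / κ ^ 3 :=
      div_nonneg (mul_nonneg hq.le (by nlinarith)) (by positivity)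
    linarith
  calc _ ≤ (q : ℝ) ^ 2 * (34 * (q / κ) + q * b) :=
        mul_le_mul_of_nonneg_left (by linarith) (by positivity)
    _ = _ := by ring

/-- Few evaluation points produce a collision among the `2 k` best items. -/
theorem card_collisions_le (h : Params n k q L m τ κ) (a : Equiv.Perm (Fin n)) :
    ((Finset.univ.filter fun u : ZMod q => ¬ ∀ j j' : Fin n, (j : ℕ) < 2 * k → (j' : ℕ) < 2 * k →
      (rsHash q u.val (a.symm j) : ZMod q) = rsHash q u.val (a.symm j') → j = j').card : ℝ) ≤
      q / κ := by
  have h10 := h.ten_le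
  have hκ : 0 < κ := by linarith
  set S := Finset.univ.filter fun j : Fin n => (j : ℕ) < 2 * k with hS
  have hScard : S.card ≤ 2 * k := by
    rw [hS, Fin.card_filter_val_lt]
    exact min_le_right _ _
  have hsub : (Finset.univ.filter fun u : ZMod q => ¬ ∀ j j' : Fin n, (j : ℕ) < 2 * k →
      (j' : ℕ) < 2 * k → (rsHash q u.val (a.symm j) : ZMod q) = rsHash q u.val (a.symm j') →
      j = j') ⊆ S.offDiag.biUnion fun p => Finset.univ.filter fun u : ZMod q =>
        (rsHash q u.val (a.symm p.1) : ZMod q) = rsHash q u.val (a.symm p.2) := by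
    intro u
    simp only [Finset.mem_filter, Finset.mem_univ, true_and, Finset.mem_biUnion,
      Finset.mem_offDiag]
    intro hu
    push Not at hu
    obtain ⟨j, j', hj, hj', heq, hne⟩ := hu
    exact ⟨(j, j'), ⟨by simpa [hS] using hj, by simpa [hS] using hj', hne⟩, heq⟩
  have hcard : (S.offDiag.biUnion fun p => Finset.univ.filter fun u : ZMod q =>
      (rsHash q u.val (a.symm p.1) : ZMod q) = rsHash q u.val (a.symm p.2)).card ≤
      S.offDiag.card * L := by
    refine Finset.card_biUnion_le_card_mul _ _ _ fun p hp => ?_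
    refine card_collision_le ((Fin.is_lt _).trans_le h.n_le) ((Fin.is_lt _).trans_le h.n_le) ?_
    intro heq
    exact (Finset.mem_offDiag.1 hp).2.2 (a.symm.injective (Fin.ext heq))
  have hoff : S.offDiag.card ≤ 2 * k * (2 * k) := by
    rw [Finset.offDiag_card]
    exact (Nat.sub_le _ _).trans (Nat.mul_le_mul hScard hScard)
  have hnat := (Finset.card_le_card hsub).trans (hcard.trans (Nat.mul_le_mul_right L hoff))
  rw [le_div_iff₀ hκ]
  have h1 : ((16 * k ^ 3 * L : ℕ) : ℝ) ≤ q := by exact_mod_cast h.le_q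
  have hκk : κ ≤ k := by
    rw [← h.cube]
    exact le_self_pow₀ (by linarith) (by norm_num)
  refine le_trans ?_ h1
  calc _ ≤ ((2 * k * (2 * k) * L : ℕ) : ℝ) * k :=
        mul_le_mul (by exact_mod_cast hnat) hκk hκ.le (Nat.cast_nonneg _)
    _ ≤ _ := by
        push_cast
        have : (0 : ℝ) ≤ k ^ 3 * L := by positivity
        nlinarith

open Classical in
/-- The failure probability of the item of rank `i`. -/
theorem sum_not_selected_le (h : Params n k q L m τ κ) (a : Equiv.Perm (Fin n))
    {i : Fin n} (hi : (i : ℕ) < k) :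
    ∑ s ∈ Finset.range (q ^ 4), (if (seedPerm n q s).symm (a.symm i) ∈
        waitAndPick m τ k (fun p => a (seedPerm n q s p)) then (0 : ℝ) else 1) ≤
      (q : ℝ) ^ 4 * (35 / κ + min 1 (8 * κ ^ 4 / ((k : ℝ) - i) ^ 2)) := by
  have h10 := h.ten_le
  have hκ : 0 < κ := by linarith
  have hq : (0 : ℝ) < q := by have := h.three_le_q; positivity
  set b := min 1 (8 * κ ^ 4 / ((k : ℝ) - i) ^ 2) with hb
  have hb0 : 0 ≤ b := le_min zero_le_one (by positivity)
  set G : ZMod q → Prop := fun u => ∀ j j' : Fin n, (j : ℕ) < 2 * k → (j' : ℕ) < 2 * k →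
      (rsHash q u.val (a.symm j) : ZMod q) = rsHash q u.val (a.symm j') → j = j' with hG
  calc _ ≤ ∑ s ∈ Finset.range (q ^ 4), (if LabelsSelect m τ k κ a i (s : ZMod q)
      ((s / q : ℕ), ((s / q / q : ℕ), (s / q / q / q : ℕ))) then (0 : ℝ) else 1) := by
        refine Finset.sum_le_sum fun s _ => ?_
        by_cases hs : LabelsSelect m τ k κ a i (s : ZMod q)
            ((s / q : ℕ), ((s / q / q : ℕ), (s / q / q / q : ℕ)))
        · rw [if_pos (h.mem_waitAndPick_of_labelsSelect hs), if_pos hs]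
        · rw [if_neg hs]
          split_ifs <;> norm_num
    _ = ∑ u : ZMod q, ∑ g, (if LabelsSelect m τ k κ a i u g then (0 : ℝ) else 1) :=
        sum_seeds fun u g => if LabelsSelect m τ k κ a i u g then (0 : ℝ) else 1
    _ ≤ ∑ u : ZMod q, ((q : ℝ) ^ 3 * (34 / κ + b) + (q : ℝ) ^ 3 * (if ¬ G u then 1 else 0)) := by
        refine Finset.sum_le_sum fun u _ => ?_
        have e1 : ∑ g, (if LabelsSelect m τ k κ a i u g then (0 : ℝ) else 1) =
            ((Finset.univ.filter fun g => ¬ LabelsSelect m τ k κ a i u g).card : ℝ) := by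
          rw [← Finset.sum_boole]
          exact Finset.sum_congr rfl fun g _ => (ite_not _ _ _).symm
        rw [e1]
        by_cases hu : G u
        · rw [if_neg (not_not.2 hu), mul_zero, add_zero]
          exact h.card_not_labelsSelect_le a hi hu
        · rw [if_pos hu, mul_one]
          have e2 : ((Finset.univ.filter fun g => ¬ LabelsSelect m τ k κ a i u g).card : ℝ) ≤
              (q : ℝ) ^ 3 := by
            have := Finset.card_le_univ
              (Finset.univ.filter fun g => ¬ LabelsSelect m τ k κ a i u g)
            rw [Fintype.card_prod, Fintype.card_prod, ZMod.card] at this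
            calc _ ≤ ((q * (q * q) : ℕ) : ℝ) := by exact_mod_cast this
              _ = (q : ℝ) ^ 3 := by push_cast; ring
          have e3 : 0 ≤ (q : ℝ) ^ 3 * (34 / κ + b) := by positivity
          linarith
    _ = (q : ℝ) ^ 4 * (34 / κ + b) +
        (q : ℝ) ^ 3 * ((Finset.univ.filter fun u : ZMod q => ¬ G u).card : ℝ) := by
        rw [Finset.sum_add_distrib, ← Finset.mul_sum, ← Finset.mul_sum, Finset.sum_boole, Finset.sum_const,
          Finset.card_univ, ZMod.card, nsmul_eq_mul]
        ring
    _ ≤ (q : ℝ) ^ 4 * (34 / κ + b) + (q : ℝ) ^ 3 * (q / κ) := by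
        have := h.card_collisions_le a
        gcongr
    _ = _ := by ring

end Params

/-! ### The competitive ratio and the theorem -/

namespace Params

variable {n k q L m τ : ℕ} {κ : ℝ}

/-- The competitive ratio for a random seed. Chebyshev's sum inequality applies because items of
higher value are better protected against a too high statistic. -/
theorem competitive [Fact q.Prime] (h : Params n k q L m τ κ) {v : Fin n → ℝ} (hv : Antitone v)
    (hv0 : ∀ i, 0 ≤ v i) (a : Equiv.Perm (Fin n)) :
    (1 - 47 / κ) * ∑ i ∈ Finset.univ.filter (fun i : Fin n => (i : ℕ) < k), v i ≤
      expectation (uniformOn (seedPerms n q)) (waitAndPickValue m τ k v a) := by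
  classical
  have h10 := h.ten_le
  have hκ : 0 < κ := by linarith
  have hq : (0 : ℝ) < q := by have := h.three_le_q; positivity
  set I := Finset.univ.filter (fun i : Fin n => (i : ℕ) < k) with hI
  have hmem : ∀ i ∈ I, (i : ℕ) < k := fun i hi => (Finset.mem_filter.1 hi).2
  have hkn : k ≤ n := by have := h.two_mul_k_le; omega
  have hIk : I.card = k := by rw [hI, Fin.card_filter_val_lt, Nat.min_eq_right hkn]
  set b : Fin n → ℝ := fun i => min 1 (8 * κ ^ 4 / ((k : ℝ) - i) ^ 2) with hb
  have hbmono : ∀ i ∈ I, ∀ j ∈ I, i ≤ j → b i ≤ b j := by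
    intro i hi j hj hij
    have h1 : ((j : ℕ) : ℝ) < k := by exact_mod_cast hmem j hj
    have h2 : ((i : ℕ) : ℝ) ≤ (j : ℕ) := by exact_mod_cast hij
    have h3 : (0 : ℝ) < (k - (j : ℕ)) ^ 2 := pow_pos (by linarith) 2
    refine min_le_min_left _ (div_le_div_of_nonneg_left (by positivity) h3 ?_)
    exact pow_le_pow_left₀ (by linarith) (by linarith) 2
  have hbsum : ∑ i ∈ I, b i ≤ 12 * κ ^ 2 := by
    have e1 : ∑ i ∈ I, b i = ∑ j ∈ Finset.range k, min 1 (8 * κ ^ 4 / ((k : ℝ) - j) ^ 2) := by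
      refine Finset.sum_bij' (fun i _ => (i : ℕ)) (fun j hj => ⟨j, ?_⟩) ?_ ?_ ?_ ?_ ?_
      · exact (Finset.mem_range.1 hj).trans_le hkn
      · exact fun i hi => Finset.mem_range.2 (hmem i hi)
      · intro j hj; simpa [hI] using hj
      · intro i _; rfl
      · intro j _; rfl
      · intro i _; rfl
    rw [e1, ← Finset.sum_range_reflect]
    refine le_trans (Finset.sum_le_sum fun d hd => ?_)
      ((sum_min_sq_div_le (A := 3 * κ ^ 2) (by positivity) k).trans_eq (by ring))
    have hdk : d < k := Finset.mem_range.1 hd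
    have hcast : ((k - 1 - d : ℕ) : ℝ) = k - (d + 1) := by
      rw [Nat.sub_sub, Nat.cast_sub (by omega)]; push_cast; ring
    rw [hcast, sub_sub_cancel]
    refine min_le_min_left _ (div_le_div_of_nonneg_right ?_ (by positivity))
    nlinarith [pow_pos hκ 4]
  have hcheb : (k : ℝ) * ∑ i ∈ I, v i * b i ≤ (∑ i ∈ I, v i) * ∑ i ∈ I, b i := by
    have hanti : AntivaryOn v b I := by
      intro i hi j hj hlt
      refine hv (le_of_lt ?_)
      by_contra! hle
      exact absurd (hbmono j hj i hi hle) (not_le.2 hlt)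
    have := hanti.card_mul_sum_le_sum_mul_sum
    rwa [hIk] at this
  have hV : 0 ≤ ∑ i ∈ I, v i := Finset.sum_nonneg fun i _ => hv0 i
  have hvb : ∑ i ∈ I, v i * b i ≤ 12 / κ * ∑ i ∈ I, v i := by
    have e1 : (k : ℝ) * ∑ i ∈ I, v i * b i ≤ (∑ i ∈ I, v i) * (12 * κ ^ 2) :=
      hcheb.trans (mul_le_mul_of_nonneg_left hbsum hV)
    rw [← h.cube] at e1
    refine le_of_mul_le_mul_left (e1.trans_eq ?_) (show 0 < κ ^ 3 by positivity)
    field_simp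
  set sel : ℕ → Fin n → ℝ := fun s i => if (seedPerm n q s).symm (a.symm i) ∈
    waitAndPick m τ k (fun p => a (seedPerm n q s p)) then 1 else 0 with hsel
  have hsum : ∀ i ∈ I, (q : ℝ) ^ 4 * (1 - 35 / κ - b i) ≤ ∑ s ∈ Finset.range (q ^ 4), sel s i := by
    intro i hi
    have e1 := h.sum_not_selected_le a (hmem i hi)
    have e2 : ∑ s ∈ Finset.range (q ^ 4), sel s i + ∑ s ∈ Finset.range (q ^ 4),
        (if (seedPerm n q s).symm (a.symm i) ∈
        waitAndPick m τ k (fun p => a (seedPerm n q s p)) then (0 : ℝ) else 1) = (q : ℝ) ^ 4 := by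
      rw [← Finset.sum_add_distrib, Finset.sum_congr rfl (g := fun _ => (1 : ℝ))]
      · simp
      · intro s _
        simp only [hsel]
        split_ifs <;> norm_num
    have e3 : (q : ℝ) ^ 4 * (1 - 35 / κ - b i) = (q : ℝ) ^ 4 - (q : ℝ) ^ 4 * (35 / κ + b i) := by
      ring
    linarith
  rw [expectation_uniformOn, seedPerms, List.length_map, List.length_range, List.map_map,
    Nat.cast_pow, le_div_iff₀ (by positivity), ← List.sum_toFinset _ List.nodup_range,
    List.toFinset_range]
  calc (1 - 47 / κ) * (∑ i ∈ I, v i) * (q : ℝ) ^ 4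
      ≤ (q : ℝ) ^ 4 * ((1 - 35 / κ) * (∑ i ∈ I, v i) - ∑ i ∈ I, v i * b i) := by
        rw [mul_comm]
        refine mul_le_mul_of_nonneg_left ?_ (by positivity)
        have : (1 - 47 / κ) * (∑ i ∈ I, v i) =
          (1 - 35 / κ) * (∑ i ∈ I, v i) - 12 / κ * ∑ i ∈ I, v i := by ring
        linarith
    _ = ∑ i ∈ I, v i * ((q : ℝ) ^ 4 * (1 - 35 / κ - b i)) := by
        rw [Finset.mul_sum, ← Finset.sum_sub_distrib, Finset.mul_sum]
        exact Finset.sum_congr rfl fun i _ => by ring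
    _ ≤ ∑ i ∈ I, v i * ∑ s ∈ Finset.range (q ^ 4), sel s i :=
        Finset.sum_le_sum fun i hi => mul_le_mul_of_nonneg_left (hsum i hi) (hv0 i)
    _ = ∑ s ∈ Finset.range (q ^ 4), ∑ i ∈ I, v i * sel s i := by
        simp_rw [Finset.mul_sum]
        exact Finset.sum_comm
    _ ≤ _ := by
        refine Finset.sum_le_sum fun s _ => ?_
        exact le_waitAndPickValue m τ k hv0 a (seedPerm n q s) I

end Params

section Numerics

open Real

theorem logb_two_lt_size {n : ℕ} (hn : n ≠ 0) : logb 2 n < n.size := by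
  rw [logb_lt_iff_lt_rpow (by norm_num) (by positivity), rpow_natCast]
  exact_mod_cast Nat.lt_size_self n

theorem size_le_logb_two_add_one {n : ℕ} (hn : n ≠ 0) : (n.size : ℝ) ≤ logb 2 n + 1 := by
  have hpos : 0 < n.size := Nat.size_pos.2 (Nat.pos_of_ne_zero hn)
  have h1 : 2 ^ (n.size - 1) ≤ n := Nat.lt_size.1 (by omega)
  have h2 : ((n.size - 1 : ℕ) : ℝ) ≤ logb 2 n := by
    rw [le_logb_iff_rpow_le (by norm_num) (by positivity), rpow_natCast]
    exact_mod_cast h1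
  rw [Nat.cast_sub hpos, Nat.cast_one] at h2
  linarith

/-- The second factor of the bound on the competitive ratio, for `k = κ ^ 3`, is positive if `k` is
large. -/
theorem five_logb_lt_of_large {κ : ℝ} (hκ : 2 ^ 12 < κ) : 5 * logb 2 (κ ^ 3) < κ := by
  have hκ0 : 0 < κ := lt_trans (by norm_num) hκ
  set r := √κ with hr
  have hr2 : r ^ 2 = κ := sq_sqrt hκ0.le
  have hr0 : 0 < r := sqrt_pos.2 hκ0
  have hr64 : 64 < r := by
    rw [hr, lt_sqrt (by norm_num)]
    linarith
  have h1 : log κ ≤ 2 * r := by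
    rw [← hr2, log_pow]
    have := log_le_sub_one_of_pos hr0
    push_cast
    linarith
  have h2 : logb 2 κ ≤ 3 * r := by
    rw [logb, div_le_iff₀ (log_pos (by norm_num))]
    have := log_two_gt_d9
    nlinarith
  rw [logb_pow]
  push_cast
  nlinarith

/-- If the second factor of the bound on the competitive ratio is positive, then `k = κ ^ 3` is large:
a lower bound on `log k` gives one on `κ`, which gives a better one on `log k`. -/
theorem seventy_le_of_five_logb_lt {κ : ℝ} (hκ0 : 0 < κ) (h2 : 2 ≤ κ ^ 3)
    (h : 5 * logb 2 (κ ^ 3) < κ) : 70 ≤ 5 * logb 2 (κ ^ 3) := by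
  have hpos : 0 < κ ^ 3 := by positivity
  have step : ∀ j : ℕ, (2 : ℝ) ^ j ≤ κ ^ 3 → (j : ℝ) ≤ logb 2 (κ ^ 3) := fun j hj => by
    rwa [le_logb_iff_rpow_le (by norm_num) hpos, rpow_natCast]
  have h1 := step 1 (by linarith)
  have e5 : (5 : ℝ) ≤ κ := by push_cast at h1; linarith
  have h6 := step 6 (le_trans (by norm_num) (pow_le_pow_left₀ (by norm_num) e5 3))
  have e30 : (30 : ℝ) ≤ κ := by push_cast at h6; linarith
  have h14 := step 14 (le_trans (by norm_num) (pow_le_pow_left₀ (by norm_num) e30 3))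
  push_cast at h14
  linarith

/-- The requirements on `n`: the first one makes `k ^ 4 ≤ log n` for `k ≤ 2 ^ 36`, and the second one
makes `q ^ 2 ≤ n`. -/
theorem eventually_large : ∃ n₀ : ℕ, ∀ n : ℕ, n₀ ≤ n →
    2 ^ 144 ≤ logb 2 n ∧ 1024 * logb 2 n ^ 8 ≤ n := by
  have h1 : Filter.Tendsto (fun n : ℕ => logb 2 (n : ℝ)) Filter.atTop Filter.atTop :=
    (tendsto_logb_atTop (by norm_num)).comp tendsto_natCast_atTop_atTop
  have h2 := tendsto_natCast_atTop_atTop (R := ℝ) |>.eventually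
    ((isLittleO_pow_log_id_atTop (n := 8)).bound (show (0 : ℝ) < 1 / 2 ^ 18 by norm_num))
  obtain ⟨n₀, hn₀⟩ := Filter.eventually_atTop.1 ((h1.eventually_ge_atTop (2 ^ 144)).and h2)
  refine ⟨n₀, fun n hn => ⟨(hn₀ n hn).1, ?_⟩⟩
  have h3 := (hn₀ n hn).2
  have h4 := (hn₀ n hn).1
  simp only [id, norm_eq_abs, Nat.abs_cast] at h3
  rw [abs_of_nonneg (by positivity)] at h3
  have h5 : logb 2 (n : ℝ) ≤ 2 * log n := by
    have hl : 0 ≤ log (n : ℝ) := log_natCast_nonneg n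
    rw [logb, div_le_iff₀ (log_pos (by norm_num))]
    have := log_two_gt_d9
    nlinarith
  have h6 := pow_le_pow_left₀ (le_trans (by positivity) h4) h5 8
  rw [mul_pow] at h6
  linarith

end Numerics

/-- The numbers used by the algorithm satisfy the assumptions of the analysis. -/
theorem params_of_large {n k : ℕ} {κ : ℝ} (hκ : 10 ≤ κ) (hcube : κ ^ 3 = k)
    (hk : (k : ℝ) ^ 4 ≤ Real.logb 2 n) (hn : 1024 * Real.logb 2 n ^ 8 ≤ n)
    (hx : 2 ≤ Real.logb 2 n) :
    Params n k (nextPrime (n.size ^ 4)) n.size ⌊(n : ℝ) / κ⌋₊ ⌊κ ^ 2⌋₊ κ := by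
  have hn0 : n ≠ 0 := by
    rintro rfl
    norm_num at hx
  have hℓ0 : n.size ≠ 0 := by simpa [Nat.size_eq_zero] using hn0
  have hκ0 : 0 < κ := by linarith
  have hkℓ : k ^ 4 ≤ n.size := by
    have : (k : ℝ) ^ 4 < n.size := hk.trans_lt (logb_two_lt_size hn0)
    exact_mod_cast this.le
  have hk16 : 16 ≤ k := by
    have h1 : (10 : ℝ) ^ 3 ≤ κ ^ 3 := pow_le_pow_left₀ (by norm_num) hκ 3
    have : (16 : ℝ) ≤ k := by rw [← hcube]; linarith
    exact_mod_cast this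
  have hp := prime_nextPrime (n.size ^ 4)
  refine ⟨hκ, hcube, Nat.one_le_iff_ne_zero.2 hℓ0, ?_, ?_, ?_, Nat.floor_le (by positivity), ?_,
    Nat.floor_le (by positivity), ?_⟩
  · calc 16 * k ^ 3 * n.size ≤ k * k ^ 3 * n.size := by gcongr
      _ = k ^ 4 * n.size := by ring
      _ ≤ n.size * n.size := by gcongr
      _ = n.size ^ 2 := by ring
      _ ≤ n.size ^ 4 := Nat.pow_le_pow_right (Nat.pos_of_ne_zero hℓ0) (by norm_num)
      _ ≤ _ := (lt_nextPrime _).le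
  · have h1 : (nextPrime (n.size ^ 4) : ℝ) ≤ 2 * n.size ^ 4 := by
      exact_mod_cast nextPrime_le (pow_ne_zero 4 hℓ0)
    have h2 : (n.size : ℝ) ≤ 2 * Real.logb 2 n := by
      linarith [size_le_logb_two_add_one hn0]
    have h3 : (nextPrime (n.size ^ 4) : ℝ) ^ 2 ≤ n := by
      calc (nextPrime (n.size ^ 4) : ℝ) ^ 2 ≤ (2 * (2 * Real.logb 2 n) ^ 4) ^ 2 := by
            refine pow_le_pow_left₀ (by positivity) (h1.trans ?_) 2
            gcongr
        _ = 1024 * Real.logb 2 n ^ 8 := by ring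
        _ ≤ n := hn
    exact_mod_cast h3
  · exact (Nat.lt_size_self n).le.trans (Nat.pow_le_pow_left hp.two_le _)
  · linarith [Nat.lt_floor_add_one ((n : ℝ) / κ)]
  · linarith [Nat.lt_floor_add_one (κ ^ 2)]

theorem logb_length_seedPerms_le {n : ℕ} (hx : 4 ≤ Real.logb 2 n) :
    Real.logb 2 (seedPerms n (nextPrime (n.size ^ 4))).length ≤
      36 * Real.logb 2 (Real.logb 2 n) := by
  have hn0 : n ≠ 0 := by
    rintro rfl
    norm_num at hx
  have hℓ0 : n.size ≠ 0 := by simpa [Nat.size_eq_zero] using hn0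
  have hx0 : 0 < Real.logb 2 n := by linarith
  have hlog : 1 ≤ Real.logb 2 (Real.logb 2 n) := by
    rw [Real.le_logb_iff_rpow_le (by norm_num) hx0, Real.rpow_one]
    linarith
  have h1 : (nextPrime (n.size ^ 4) : ℝ) ≤ 2 * n.size ^ 4 := by
    exact_mod_cast nextPrime_le (pow_ne_zero 4 hℓ0)
  have h2 : (n.size : ℝ) ≤ 2 * Real.logb 2 n := by
    linarith [size_le_logb_two_add_one hn0]
  have h3 : (nextPrime (n.size ^ 4) : ℝ) ≤ 2 ^ 5 * Real.logb 2 n ^ 4 :=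
    calc (nextPrime (n.size ^ 4) : ℝ) ≤ 2 * (2 * Real.logb 2 n) ^ 4 := h1.trans (by gcongr)
      _ = _ := by ring
  have hpos : (0 : ℝ) < nextPrime (n.size ^ 4) := by
    exact_mod_cast (prime_nextPrime (n.size ^ 4)).pos
  have h4 := Real.logb_le_logb_of_le (b := 2) (by norm_num) hpos h3
  rw [Real.logb_mul (by positivity) (by positivity), Real.logb_pow, Real.logb_pow,
    Real.logb_self_eq_one (by norm_num)] at h4
  have hlen : (seedPerms n (nextPrime (n.size ^ 4))).length = nextPrime (n.size ^ 4) ^ 4 := by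
    simp [seedPerms]
  rw [hlen, Nat.cast_pow, Real.logb_pow]
  push_cast at h4 ⊢
  linarith

theorem theorem2 :
    ∃ (prog : Ram.Prog) (T : Polynomial ℕ) (C : ℝ) (n₀ : ℕ),
      ∀ n : ℕ, n₀ ≤ n → ∀ k : ℕ, 2 ≤ k →
        (k : ℝ) ≤ Real.logb 2 n / Real.logb 2 (Real.logb 2 n) →
        ∃ L : List (Equiv.Perm (Fin n)), L ≠ [] ∧
          -- the multi-set is computed in time polynomial in `n`
          (∃ (t : ℕ) (s : Ram.State),
            Ram.Exec prog (Ram.input n k) t s ∧ t ≤ T.eval n ∧ Ram.Outputs s L) ∧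
          -- the entropy of the uniform distribution on it is `O(log log n)`
          Real.logb 2 (L.length : ℝ) ≤ C * Real.logb 2 (Real.logb 2 n) ∧
          shannonEntropy (uniformOn L) ≤ C * Real.logb 2 (Real.logb 2 n) ∧
          -- the competitive ratio, against every adversary
          ∀ (v : Fin n → ℝ) (a : Equiv.Perm (Fin n)), Antitone v → (∀ i, 0 ≤ v i) →
            (1 - (k : ℝ) ^ 2 / Real.sqrt (Real.logb 2 n)) *
                (1 - 5 * Real.logb 2 k / (k : ℝ) ^ ((1 : ℝ) / 3)) *
                ∑ i ∈ Finset.univ.filter (fun i : Fin n => (i : ℕ) < k), v i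
              ≤ expectation (uniformOn L)
                  (waitAndPickValue ⌊(n : ℝ) / (k : ℝ) ^ ((1 : ℝ) / 3)⌋₊
                    ⌊(k : ℝ) ^ ((2 : ℝ) / 3)⌋₊ k v a) := by
  obtain ⟨n₀, hn₀⟩ := eventually_large
  refine ⟨Ram.permsProg, Ram.permsProg.costPoly.comp Ram.cellPoly, 36, n₀, ?_⟩
  intro n hn k hk2 hk
  obtain ⟨hx, hx8⟩ := hn₀ n hn
  set x := Real.logb 2 n with hxdef
  have hx4 : 4 ≤ x := le_trans (by norm_num) hx
  have hx0 : 0 < x := by linarith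
  have hn0 : n ≠ 0 := by
    rintro rfl
    norm_num [hxdef] at hx4
  have hkn : k ≤ n := by
    have h1 : 1 ≤ Real.logb 2 x := by
      rw [Real.le_logb_iff_rpow_le (by norm_num) hx0, Real.rpow_one]
      linarith
    have h2 : (k : ℝ) ≤ n := by
      calc (k : ℝ) ≤ x := hk.trans (div_le_self hx0.le h1)
        _ ≤ x ^ 8 := le_self_pow₀ (by linarith) (by norm_num)
        _ ≤ 1024 * x ^ 8 := le_mul_of_one_le_left (by positivity) (by norm_num)
        _ ≤ n := hx8
    exact_mod_cast h2
  set q := nextPrime (n.size ^ 4) with hq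
  have hqp : q.Prime := prime_nextPrime _
  have hne : seedPerms n q ≠ [] := by
    simp [seedPerms, hqp.ne_zero]
  have hlen := logb_length_seedPerms_le hx4
  refine ⟨seedPerms n q, hne, Ram.permsProg_spec hn0 hkn, hlen,
    (shannonEntropy_uniformOn_le hne).trans hlen, ?_⟩
  intro v a hv hv0
  have hk0 : (0 : ℝ) < k := by positivity
  set κ : ℝ := (k : ℝ) ^ ((1 : ℝ) / 3) with hκdef
  have hκ0 : 0 < κ := by positivity
  have hcube : κ ^ 3 = k := by
    rw [hκdef, ← Real.rpow_natCast, ← Real.rpow_mul hk0.le]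
    norm_num
  have hsq : (k : ℝ) ^ ((2 : ℝ) / 3) = κ ^ 2 := by
    rw [hκdef, ← Real.rpow_natCast, ← Real.rpow_mul hk0.le]
    norm_num
  rw [hsq]
  set V := ∑ i ∈ Finset.univ.filter (fun i : Fin n => (i : ℕ) < k), v i
  have hV : 0 ≤ V := Finset.sum_nonneg fun i _ => hv0 i
  -- When the left-hand side is not positive, the claim is trivial.
  have hE : 0 ≤ expectation (uniformOn (seedPerms n q))
      (waitAndPickValue ⌊(n : ℝ) / κ⌋₊ ⌊κ ^ 2⌋₊ k v a) :=
    Finset.sum_nonneg fun π _ =>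
      mul_nonneg (by unfold uniformOn; positivity) (waitAndPickValue_nonneg _ _ _ hv0 a π)
  have hsx : 0 < √x := Real.sqrt_pos.2 hx0
  rcases le_or_gt κ (5 * Real.logb 2 k) with hsmall | hlarge
  · -- Here `k` is bounded, so that the first factor is nonnegative because `n` is large.
    have hκ12 : κ ≤ 2 ^ 12 := by
      by_contra! h
      have := five_logb_lt_of_large h
      rw [hcube] at this
      linarith
    have hk36 : (k : ℝ) ≤ 2 ^ 36 := by
      rw [← hcube]
      exact (pow_le_pow_left₀ hκ0.le hκ12 3).trans (by norm_num)
    have h1 : 0 ≤ 1 - (k : ℝ) ^ 2 / √x := by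
      rw [sub_nonneg, div_le_one hsx]
      refine Real.le_sqrt_of_sq_le (le_trans ?_ hx)
      calc ((k : ℝ) ^ 2) ^ 2 ≤ (((2 : ℝ) ^ 36) ^ 2) ^ 2 := by gcongr
        _ = 2 ^ 144 := by rw [← pow_mul, ← pow_mul]
    have h2 : 1 - 5 * Real.logb 2 k / κ ≤ 0 := by
      rw [sub_nonpos, one_le_div hκ0]
      exact hsmall
    exact (mul_nonpos_of_nonpos_of_nonneg (mul_nonpos_of_nonneg_of_nonpos h1 h2) hV).trans hE
  · have h2 : 0 ≤ 1 - 5 * Real.logb 2 k / κ := by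
      rw [sub_nonneg, div_le_one hκ0]
      exact hlarge.le
    rcases le_or_gt (√x) ((k : ℝ) ^ 2) with hkx | hkx
    · have h1 : 1 - (k : ℝ) ^ 2 / √x ≤ 0 := by
        rw [sub_nonpos, one_le_div hsx]
        exact hkx
      exact (mul_nonpos_of_nonpos_of_nonneg (mul_nonpos_of_nonpos_of_nonneg h1 h2) hV).trans hE
    · have hk4 : (k : ℝ) ^ 4 ≤ x := by
        have := pow_le_pow_left₀ (by positivity) hkx.le 2
        rw [Real.sq_sqrt hx0.le] at this
        calc (k : ℝ) ^ 4 = ((k : ℝ) ^ 2) ^ 2 := by ring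
          _ ≤ x := this
      have h70 : 70 ≤ 5 * Real.logb 2 k := by
        rw [← hcube]
        refine seventy_le_of_five_logb_lt hκ0 ?_ ?_
        · rw [hcube]; exact_mod_cast hk2
        · rw [hcube]; exact hlarge
      have hP := params_of_large (by linarith) hcube hk4 hx8 (by linarith)
      have : Fact (Nat.Prime (nextPrime (n.size ^ 4))) := ⟨hqp⟩
      refine le_trans ?_ (hP.competitive hv hv0 a)
      refine mul_le_mul_of_nonneg_right ?_ hV
      have h1 : 1 - (k : ℝ) ^ 2 / √x ≤ 1 := by
        have : 0 ≤ (k : ℝ) ^ 2 / √x := by positivity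
        linarith
      calc (1 - (k : ℝ) ^ 2 / √x) * (1 - 5 * Real.logb 2 k / κ)
          ≤ 1 - 5 * Real.logb 2 k / κ := mul_le_of_le_one_left h2 h1
        _ ≤ 1 - 47 / κ := by
          have : 47 / κ ≤ 5 * Real.logb 2 k / κ := by gcongr; linarith
          linarith
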